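/- Let $X,Y,M$ be finite-dimensional Hilbert spaces, let $A,B$ be positive integers and let $0<\epsilon<1$. Logarithms are to base $2$. A subnormalised density matrix is a positive semidefinite matrix of trace at most one; a normalised density matrix has trace exactly one. For a subnormalised density matrix $\omega$ and a positive semidefinite matrix $\theta$ on the same space let \[ D_2(\omega\|\theta) := 2\log\bigl\|\theta^{-1/4}\,\omega\,\theta^{-1/4}\bigr\|_2 \quad\text{if } \mathrm{supp}(\omega)\subseteq\mathrm{supp}(\theta), \qquad D_2(\omega\|\theta):=+\infty \text{ otherwise}, \] where $\theta^{-1/4}$ is taken on the support of $\theta$, $\|\cdot\|_p$ is the Schatten $p$-norm and $\log 0:=-\infty$. Let \[ D_2^\epsilon(\omega\|\theta) := \min\{D_2(\omega'\|\theta) : \omega' \text{ a subnormalised density matrix with } \|\omega'-\omega\|_1\le \epsilon\,\mathrm{Tr}\,\omega\}. \] Let $\rho^{XYM}\neq 0$ be a subnormalised density matrix on $X\otimes Y\otimes M$, with marginals denoted by superscripts, and let $\alpha^X$, $\beta^Y$ be normalised density matrices with $\mathrm{supp}(\rho^X)\subseteq\mathrm{supp}(\alpha^X)$ and $\mathrm{supp}(\rho^Y)\subseteq\mathrm{supp}(\beta^Y)$.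 Define the convex split state and the fully decoupled state on $X^{\otimes A}\otimes Y^{\otimes B}\otimes M$ by \[ \sigma := \frac{1}{AB}\sum_{a=1}^{A}\sum_{b=1}^{B} \rho^{X_aY_bM}\otimes\alpha^{X^{-a}}\otimes\beta^{Y^{-b}}, \qquad \tau := (\alpha^X)^{\otimes A}\otimes(\beta^Y)^{\otimes B}\otimes\rho^M, \] where $\rho^{X_aY_bM}$ acts on the $a$-th copy of $X$, the $b$-th copy of $Y$ and $M$, and $\alpha^{X^{-a}}$, $\beta^{Y^{-b}}$ are the tensor powers of $\alpha^X$, $\beta^Y$ on all the other copies. Suppose that \begin{align*} \log A &> D_2^\epsilon(\rho^{XM}\,\|\,\alpha^X\otimes\rho^M)-\log\mathrm{Tr}\,\rho+\log\epsilon^{-2},\\ \log B &> D_2^\epsilon(\rho^{YM}\,\|\,\beta^Y\otimes\rho^M)-\log\mathrm{Tr}\,\rho+\log\epsilon^{-2},\\ \log A+\log B &> D_2^\epsilon(\rho^{XYM}\,\|\,\alpha^X\otimes\beta^Y\otimes\rho^M)-\log\mathrm{Tr}\,\rho+\log\epsilon^{-2}. \end{align*} (The term $\log\mathrm{Tr}\,\rho$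 vanishes when $\rho$ is normalised; it makes the conditions invariant under rescaling $\rho$.) Then \[ \|\sigma-\tau\|_1 < 16\,\epsilon\,\mathrm{Tr}\,\rho . \] -/

import Mathlib

open scoped Kronecker ComplexOrder

noncomputable section

namespace ConvexSplit

variable {n x y m : Type*} [Fintype n] [DecidableEq n] [Fintype x] [DecidableEq x]
  [Fintype y] [DecidableEq y] [Fintype m] [DecidableEq m]

/-- A subnormalised density matrix: positive semidefinite with trace at most one. -/
def IsSubnormalised (ρ : Matrix n n ℂ) : Prop :=
  ρ.PosSemidef ∧ ρ.trace.re ≤ 1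

/-- A normalised density matrix: positive semidefinite with trace exactly one. -/
def IsDensity (ρ : Matrix n n ℂ) : Prop :=
  ρ.PosSemidef ∧ ρ.trace = 1

/-- The support of a Hermitian matrix, that is, its range. -/
def supp (ρ : Matrix n n ℂ) : Submodule ℂ (n → ℂ) :=
  LinearMap.range ρ.mulVecLin

/-- The Schatten-1 norm `Tr[(Tᴴ T)^{1/2}]`. -/
def traceNorm (T : Matrix n n ℂ) : ℝ :=
  (cfc Real.sqrt (T.conjTranspose * T)).trace.re

/-- The Schatten-2 norm `(Tr[Tᴴ T])^{1/2}`. -/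
def hsNorm (T : Matrix n n ℂ) : ℝ :=
  Real.sqrt (T.conjTranspose * T).trace.re

/-- `β^{-1/4}` for a positive semidefinite `β`, taken on the support of `β` and zero on its
kernel (for real powers in Mathlib, `0 ^ (-1/4) = 0`). -/
def invFourthRoot (β : Matrix n n ℂ) : Matrix n n ℂ :=
  cfc (fun t : ℝ => t ^ (-(1 / 4) : ℝ)) β

open Classical in
/-- The Rényi-2 divergence `D₂(α‖β) = 2 log₂ ‖β^{-1/4} α β^{-1/4}‖₂` if
`supp α ≤ supp β`, and `+∞` otherwise; here `log 0 = -∞`. -/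
def D2 (α β : Matrix n n ℂ) : EReal :=
  if supp α ≤ supp β then
    if hsNorm (invFourthRoot β * α * invFourthRoot β) = 0 then ⊥
    else ((2 * Real.logb 2 (hsNorm (invFourthRoot β * α * invFourthRoot β)) : ℝ) : EReal)
  else ⊤

/-- The `ε`-smooth Rényi-2 divergence: the minimum of `D₂(α'‖β)` over all subnormalised density
matrices `α'` with `‖α' - α‖₁ ≤ ε Tr α`. -/
def smoothD2 (ε : ℝ) (α β : Matrix n n ℂ) : EReal :=
  ⨅ α' ∈ {α' : Matrix n n ℂ | IsSubnormalised α' ∧ traceNorm (α' - α) ≤ ε * α.trace.re},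
    D2 α' β

/-- The marginal on `X ⊗ M` of a matrix on `X ⊗ Y ⊗ M`. -/
def margXM (ρ : Matrix (x × y × m) (x × y × m) ℂ) : Matrix (x × m) (x × m) ℂ :=
  Matrix.of fun i j => ∑ b : y, ρ (i.1, b, i.2) (j.1, b, j.2)

/-- The marginal on `Y ⊗ M` of a matrix on `X ⊗ Y ⊗ M`. -/
def margYM (ρ : Matrix (x × y × m) (x × y × m) ℂ) : Matrix (y × m) (y × m) ℂ :=
  Matrix.of fun i j => ∑ a : x, ρ (a, i.1, i.2) (a, j.1, j.2)

/-- The marginal on `X` of a matrix on `X ⊗ Y ⊗ M`. -/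
def margX (ρ : Matrix (x × y × m) (x × y × m) ℂ) : Matrix x x ℂ :=
  Matrix.of fun i j => ∑ b : y, ∑ c : m, ρ (i, b, c) (j, b, c)

/-- The marginal on `Y` of a matrix on `X ⊗ Y ⊗ M`. -/
def margY (ρ : Matrix (x × y × m) (x × y × m) ℂ) : Matrix y y ℂ :=
  Matrix.of fun i j => ∑ a : x, ∑ c : m, ρ (a, i, c) (a, j, c)

/-- The marginal on `M` of a matrix on `X ⊗ Y ⊗ M`. -/
def margM (ρ : Matrix (x × y × m) (x × y × m) ℂ) : Matrix m m ℂ :=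
  Matrix.of fun i j => ∑ a : x, ∑ b : y, ρ (a, b, i) (a, b, j)

/-- The tensor power `α^{⊗ A}`; the basis of the tensor power of `A` copies of `X` is indexed by
`Fin A → x`. -/
def tensorPow (A : ℕ) (α : Matrix x x ℂ) : Matrix (Fin A → x) (Fin A → x) ℂ :=
  Matrix.of fun s t => ∏ i, α (s i) (t i)

/-- The matrix `ρ^{X_a Y_b M} ⊗ α^{X^{-a}} ⊗ β^{Y^{-b}}`: `ρ` sits on the `a`-th copy of `X`, the
`b`-th copy of `Y` and on `M`, and `α`, `β` sit on all other copies of `X` and `Y`. -/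
def placed {A B : ℕ} (ρ : Matrix (x × y × m) (x × y × m) ℂ) (α : Matrix x x ℂ)
    (β : Matrix y y ℂ) (a : Fin A) (b : Fin B) :
    Matrix ((Fin A → x) × (Fin B → y) × m) ((Fin A → x) × (Fin B → y) × m) ℂ :=
  Matrix.of fun s t =>
    ρ (s.1 a, s.2.1 b, s.2.2) (t.1 a, t.2.1 b, t.2.2)
      * (∏ i ∈ Finset.univ.erase a, α (s.1 i) (t.1 i))
      * (∏ j ∈ Finset.univ.erase b, β (s.2.1 j) (t.2.1 j))

/-- The convex split state `(AB)⁻¹ ∑_a ∑_b ρ^{X_a Y_b M} ⊗ α^{X^{-a}} ⊗ β^{Y^{-b}}`. -/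
def convexSplitState (A B : ℕ) (ρ : Matrix (x × y × m) (x × y × m) ℂ) (α : Matrix x x ℂ)
    (β : Matrix y y ℂ) :
    Matrix ((Fin A → x) × (Fin B → y) × m) ((Fin A → x) × (Fin B → y) × m) ℂ :=
  ((A : ℂ) * (B : ℂ))⁻¹ • ∑ a : Fin A, ∑ b : Fin B, placed ρ α β a b

/-- The fully decoupled state `α^{⊗ A} ⊗ β^{⊗ B} ⊗ ρ^M`. -/
def decoupledState (A B : ℕ) (ρ : Matrix (x × y × m) (x × y × m) ℂ) (α : Matrix x x ℂ)
    (β : Matrix y y ℂ) :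
    Matrix ((Fin A → x) × (Fin B → y) × m) ((Fin A → x) × (Fin B → y) × m) ℂ :=
  tensorPow A α ⊗ₖ (tensorPow B β ⊗ₖ margM ρ)

end ConvexSplit

end

/-! Write E_X K = α ⊗ Tr_X K, E_Y K = β ⊗ Tr_Y K, and let S be the convex split map, which is linear
in the state. Since S sends E_X E_Y ρ to τ, the difference σ - τ is the sum of S(1-E_Y)(1-E_X)ρ,
S(1-E_X)E_Y ρ and S(1-E_Y)E_X ρ (`convexSplitState_sub_decoupledState`). These pieces depend on ρ,
on ρ^{XM} and on ρ^{YM} respectively, so each can be smoothed separately, with its own hypothesis,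
and no common smoothing state is needed.

A smoothed state has the form θ^{1/4} K θ^{1/4}, with the divergence controlling ‖K‖₂. Hölder
(`traceNorm_mul_mul_le`) reduces the trace norm of a piece to the Hilbert–Schmidt norm of the split
image of K, with √α and √β in place of α and β (`splitMap_mul_mul`). In that picture √α, √β are unit
vectors and E_X, E_Y become orthogonal projections (`replaceFst_mul_mul`). Removing such a
projection makes the summands at different positions orthogonal, so summing over a multiplies the
squared norm by A instead of A² (`sum_norm_sum_placeVec_sq`), and likewise for b. After division by
(AB)² the gains are 1/(AB), 1/A and 1/B, which the three hypotheses turn into ε Tr ρ per piece.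

S, E_X and E_Y are positive and trace preserving, so each factor 1-E at most doubles a smoothing
error; the errors are 4, 2 and 2 times ε Tr ρ. The total is 11 ε Tr ρ. -/

open Matrix

set_option linter.unusedSectionVars false

namespace ConvexSplit

/-! ### Trace norm, Hilbert–Schmidt norm and Hölder's inequality -/

section TraceNorm

variable {n : Type*} [Fintype n] [DecidableEq n]

/-- The spectrum is finite, so the functional calculus also admits discontinuous functions such as
the sign and t^{-1/4}. -/
theorem continuousOn_spectrum (T : Matrix n n ℂ) (f : ℝ → ℝ) : ContinuousOn f (spectrum ℝ T) :=
  (Matrix.finite_real_spectrum (A := T)).continuousOn f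

theorem isHermitian_cfc (f : ℝ → ℝ) (T : Matrix n n ℂ) : (cfc f T).IsHermitian :=
  (cfc_predicate f T : IsSelfAdjoint _)

theorem cfc_mul_matrix (f g : ℝ → ℝ) (T : Matrix n n ℂ) :
    cfc f T * cfc g T = cfc (fun t => f t * g t) T :=
  (cfc_mul f g T (continuousOn_spectrum T f) (continuousOn_spectrum T g)).symm

theorem posSemidef_cfc {f : ℝ → ℝ} (hf : ∀ t, 0 ≤ f t) (T : Matrix n n ℂ) :
    (cfc f T).PosSemidef := by
  have h : cfc f T = (cfc (fun t => Real.sqrt (f t)) T)ᴴ * cfc (fun t => Real.sqrt (f t)) T := by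
    rw [(isHermitian_cfc _ T).eq, cfc_mul_matrix]
    simp only [Real.mul_self_sqrt (hf _)]
  rw [h]
  exact Matrix.posSemidef_conjTranspose_mul_self _

theorem cfc_congr_of_posSemidef {P : Matrix n n ℂ} (hP : P.PosSemidef) {f g : ℝ → ℝ}
    (h : ∀ t, 0 ≤ t → f t = g t) : cfc f P = cfc g P :=
  cfc_congr fun t ht => h t (by
    simpa using (Matrix.posSemidef_iff_isHermitian_and_spectrum_nonneg.mp hP).2 ht)

theorem _root_.Matrix.PosSemidef.exists_eq_conjTranspose_mul_self {P : Matrix n n ℂ}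
    (hP : P.PosSemidef) : ∃ C : Matrix n n ℂ, P = Cᴴ * C := by
  have hP' : IsSelfAdjoint P := hP.1
  refine ⟨cfc Real.sqrt P, ?_⟩
  rw [(isHermitian_cfc _ P).eq, cfc_mul_matrix, cfc_congr_of_posSemidef hP
    (fun t ht => Real.mul_self_sqrt ht), cfc_id' ℝ P]

theorem trace_mul_re_nonneg {P Q : Matrix n n ℂ} (hP : P.PosSemidef) (hQ : Q.PosSemidef) :
    0 ≤ (P * Q).trace.re := by
  obtain ⟨C, rfl⟩ := hP.exists_eq_conjTranspose_mul_self
  rw [Matrix.mul_assoc, Matrix.trace_mul_comm]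
  exact (Complex.nonneg_iff.mp (hQ.mul_mul_conjTranspose_same C).trace_nonneg).1

/-- The sign function with value `1` at `0`. -/
noncomputable def sgn (t : ℝ) : ℝ := if t < 0 then -1 else 1

theorem sgn_mul_self (t : ℝ) : sgn t * sgn t = 1 := by
  unfold sgn; split_ifs <;> norm_num

theorem sgn_mul (t : ℝ) : sgn t * t = |t| := by
  unfold sgn
  split_ifs with h
  · rw [abs_of_neg h]; ring
  · rw [abs_of_nonneg (not_lt.mp h)]; ring

theorem cfc_sqrt_conjTranspose_mul_self {T : Matrix n n ℂ} (hT : T.IsHermitian) :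
    cfc Real.sqrt (Tᴴ * T) = cfc (fun t : ℝ => |t|) T := by
  have hT' : IsSelfAdjoint T := hT
  have h : Tᴴ * T = cfc (fun t : ℝ => t * t) T := by
    rw [hT.eq, ← cfc_mul_matrix, cfc_id' ℝ T]
  rw [h, ← cfc_comp' Real.sqrt (fun t : ℝ => t * t) T
    (Set.Finite.continuousOn ((Matrix.finite_real_spectrum (A := T)).image _) _)
    (continuousOn_spectrum T _)]
  simp only [Real.sqrt_mul_self_eq_abs]

theorem traceNorm_eq_trace_sgn_mul {T : Matrix n n ℂ} (hT : T.IsHermitian) :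
    traceNorm T = (cfc sgn T * T).trace.re := by
  have hT' : IsSelfAdjoint T := hT
  have h : cfc sgn T * T = cfc (fun t : ℝ => |t|) T := by
    conv_lhs => rw [← cfc_id' ℝ T, cfc_id' ℝ T]
    nth_rewrite 2 [← cfc_id' ℝ T]
    rw [cfc_mul_matrix]
    simp only [sgn_mul]
  rw [traceNorm, cfc_sqrt_conjTranspose_mul_self hT, h]

/-- The value 1 of `sgn` at 0 is what makes this hold for singular T as well. -/
theorem cfc_sgn_mul_self {T : Matrix n n ℂ} (hT : T.IsHermitian) :
    cfc sgn T * cfc sgn T = 1 := by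
  have hT' : IsSelfAdjoint T := hT
  rw [cfc_mul_matrix]
  simp only [sgn_mul_self]
  exact cfc_const_one ℝ T

/-- `T` is a difference of positive semidefinite matrices of total trace at most `c`. For
Hermitian `T` this says that the trace norm of `T` is at most `c`. -/
def TraceBounded (T : Matrix n n ℂ) (c : ℝ) : Prop :=
  ∃ P Q : Matrix n n ℂ, P.PosSemidef ∧ Q.PosSemidef ∧ T = P - Q ∧ P.trace.re + Q.trace.re ≤ c

theorem TraceBounded.isHermitian {T : Matrix n n ℂ} {c : ℝ} (h : TraceBounded T c) :
    T.IsHermitian := by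
  obtain ⟨P, Q, hP, hQ, rfl, -⟩ := h
  exact hP.1.sub hQ.1

theorem TraceBounded.mono {T : Matrix n n ℂ} {c d : ℝ} (h : TraceBounded T c) (hcd : c ≤ d) :
    TraceBounded T d := by
  obtain ⟨P, Q, hP, hQ, hT, h⟩ := h
  exact ⟨P, Q, hP, hQ, hT, h.trans hcd⟩

theorem TraceBounded.add {S T : Matrix n n ℂ} {c d : ℝ} (hS : TraceBounded S c)
    (hT : TraceBounded T d) : TraceBounded (S + T) (c + d) := by
  obtain ⟨P, Q, hP, hQ, rfl, h⟩ := hS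
  obtain ⟨P', Q', hP', hQ', rfl, h'⟩ := hT
  refine ⟨P + P', Q + Q', hP.add hP', hQ.add hQ', by abel, ?_⟩
  simp only [Matrix.trace_add, Complex.add_re]
  linarith

theorem TraceBounded.sub {S T : Matrix n n ℂ} {c d : ℝ} (hS : TraceBounded S c)
    (hT : TraceBounded T d) : TraceBounded (S - T) (c + d) := by
  obtain ⟨P, Q, hP, hQ, rfl, h⟩ := hS
  obtain ⟨P', Q', hP', hQ', rfl, h'⟩ := hT
  refine ⟨P + Q', Q + P', hP.add hQ', hQ.add hP', by abel, ?_⟩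
  simp only [Matrix.trace_add, Complex.add_re]
  linarith

/-- Positive trace-preserving maps do not increase the trace norm. -/
theorem TraceBounded.map {k : Type*} [Fintype k] [DecidableEq k] {T : Matrix n n ℂ} {c : ℝ}
    (h : TraceBounded T c) (F : Matrix n n ℂ →ₗ[ℂ] Matrix k k ℂ)
    (hF : ∀ P : Matrix n n ℂ, P.PosSemidef → (F P).PosSemidef)
    (hF' : ∀ P : Matrix n n ℂ, (F P).trace = P.trace) : TraceBounded (F T) c := by
  obtain ⟨P, Q, hP, hQ, rfl, h⟩ := h
  refine ⟨F P, F Q, hF P hP, hF Q hQ, map_sub F P Q, ?_⟩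
  rwa [hF', hF']

/-- With S the sign of T, the trace norm is Tr SP - Tr SQ, and -1 ≤ S ≤ 1 bounds this by Tr P + Tr
Q. -/
theorem TraceBounded.traceNorm_le {T : Matrix n n ℂ} {c : ℝ} (h : TraceBounded T c) :
    traceNorm T ≤ c := by
  have hT := h.isHermitian
  have hT' : IsSelfAdjoint T := hT
  obtain ⟨P, Q, hP, hQ, hPQ, h⟩ := h
  rw [traceNorm_eq_trace_sgn_mul hT]
  have h1 : (1 - cfc sgn T).PosSemidef := by
    have : 1 - cfc sgn T = cfc (fun t => 1 - sgn t) T := by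
      rw [cfc_sub _ _ T (continuousOn_spectrum _ _) (continuousOn_spectrum _ _),
        cfc_const_one ℝ T]
    rw [this]
    exact posSemidef_cfc (fun t => by unfold sgn; split_ifs <;> norm_num) T
  have h2 : (1 + cfc sgn T).PosSemidef := by
    have : 1 + cfc sgn T = cfc (fun t => 1 + sgn t) T := by
      rw [cfc_add _ _ _ (continuousOn_spectrum _ _) (continuousOn_spectrum _ _),
        cfc_const_one ℝ T]
    rw [this]
    exact posSemidef_cfc (fun t => by unfold sgn; split_ifs <;> norm_num) T
  have h3 := trace_mul_re_nonneg h1 hP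
  have h4 := trace_mul_re_nonneg h2 hQ
  have h5 : (cfc sgn T * T).trace.re = (cfc sgn T * P).trace.re - (cfc sgn T * Q).trace.re := by
    conv_lhs => rw [show cfc sgn T * T = cfc sgn T * (P - Q) by rw [← hPQ]]
    rw [Matrix.mul_sub, Matrix.trace_sub, Complex.sub_re]
  simp only [Matrix.sub_mul, Matrix.add_mul, Matrix.one_mul, Matrix.trace_sub, Matrix.trace_add,
    Complex.sub_re, Complex.add_re] at h3 h4
  linarith

/-- Jordan decomposition into positive and negative parts. -/
theorem traceBounded_traceNorm {T : Matrix n n ℂ} (hT : T.IsHermitian) :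
    TraceBounded T (traceNorm T) := by
  have hT' : IsSelfAdjoint T := hT
  have hs := continuousOn_spectrum T
  refine ⟨cfc (fun t : ℝ => max t 0) T, cfc (fun t : ℝ => max (-t) 0) T,
    posSemidef_cfc (fun t => le_max_right _ _) T, posSemidef_cfc (fun t => le_max_right _ _) T,
    ?_, le_of_eq ?_⟩
  · rw [← cfc_sub _ _ _ (hs _) (hs _)]
    conv_lhs => rw [← cfc_id' ℝ T]
    congr 1
    funext t
    rcases le_total 0 t with h | h <;> simp [h]
  · rw [← Complex.add_re, ← Matrix.trace_add, ← cfc_add _ _ _ (hs _) (hs _), traceNorm,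
      cfc_sqrt_conjTranspose_mul_self hT]
    congr 3
    funext t
    rcases le_total 0 t with h | h <;> simp [h, abs_of_nonneg, abs_of_nonpos]

/-- The squared Hilbert–Schmidt norm. -/
noncomputable def hsSq (T : Matrix n n ℂ) : ℝ := ∑ i, ∑ j, ‖T i j‖ ^ 2

theorem trace_conjTranspose_mul_re (S T : Matrix n n ℂ) :
    (Sᴴ * T).trace = ∑ i, ∑ j, star (S i j) * T i j := by
  simp only [Matrix.trace, Matrix.diag, Matrix.mul_apply, Matrix.conjTranspose_apply]
  exact Finset.sum_comm

theorem hsSq_eq_trace (T : Matrix n n ℂ) : hsSq T = (Tᴴ * T).trace.re := by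
  rw [trace_conjTranspose_mul_re, hsSq]
  simp only [Complex.re_sum]
  refine Finset.sum_congr rfl fun i _ => Finset.sum_congr rfl fun j _ => ?_
  rw [Complex.star_def, Complex.conj_mul', ← Complex.ofReal_pow, Complex.ofReal_re]

theorem hsSq_nonneg (T : Matrix n n ℂ) : 0 ≤ hsSq T := by unfold hsSq; positivity

theorem hsNorm_sq (T : Matrix n n ℂ) : hsNorm T ^ 2 = hsSq T := by
  rw [hsNorm, ← hsSq_eq_trace, Real.sq_sqrt (hsSq_nonneg T)]

theorem trace_mul_re_le (S T : Matrix n n ℂ) :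
    (Sᴴ * T).trace.re ≤ Real.sqrt (hsSq S) * Real.sqrt (hsSq T) := by
  rw [trace_conjTranspose_mul_re]
  have h := Real.sum_mul_le_sqrt_mul_sqrt (Finset.univ : Finset (n × n))
    (fun p => ‖S p.1 p.2‖) (fun p => ‖T p.1 p.2‖)
  rw [hsSq, hsSq, ← Finset.sum_product', ← Finset.sum_product', ← Finset.sum_product',
    Complex.re_sum]
  refine le_trans (Finset.sum_le_sum fun p _ => ?_) h
  refine (Complex.re_le_norm _).trans ?_
  rw [norm_mul, norm_star]

theorem hsSq_smul (z : ℂ) (T : Matrix n n ℂ) : hsSq (z • T) = ‖z‖ ^ 2 * hsSq T := by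
  simp only [hsSq, Matrix.smul_apply, smul_eq_mul, norm_mul, mul_pow, Finset.mul_sum]

/-- Hölder's inequality in the form `‖G K G‖₁ ≤ ‖G‖₄² ‖K‖₂`. -/
theorem traceNorm_mul_mul_le {G K : Matrix n n ℂ} (hG : G.IsHermitian)
    (hT : (G * K * G).IsHermitian) :
    traceNorm (G * K * G) ≤ Real.sqrt (G * G * (G * G)).trace.re * Real.sqrt (hsSq K) := by
  set S := cfc sgn (G * K * G) with hS
  have hSh : S.IsHermitian := isHermitian_cfc _ _
  have hSS : S * S = 1 := cfc_sgn_mul_self hT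
  have hGSG : (G * S * G)ᴴ = G * S * G := by
    simp only [Matrix.conjTranspose_mul, hG.eq, hSh.eq, Matrix.mul_assoc]
  rw [traceNorm_eq_trace_sgn_mul hT, ← hS]
  -- Cyclicity moves both factors G onto the sign S; Cauchy–Schwarz then splits off K and leaves
  -- ‖GSG‖₂.
  have e1 : (S * (G * K * G)).trace = ((G * S * G)ᴴ * K).trace := by
    rw [hGSG, ← Matrix.mul_assoc, Matrix.trace_mul_comm]
    simp only [Matrix.mul_assoc]
  rw [e1]
  refine (trace_mul_re_le _ _).trans ?_
  gcongr
  rw [hsSq_eq_trace, hGSG]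
  have hG2 : (G * G)ᴴ = G * G := by rw [Matrix.conjTranspose_mul, hG.eq]
  -- A second Cauchy–Schwarz: ‖GSG‖₂² is the inner product of SG² and G²S, both of squared norm Tr
  -- G⁴ because S² = 1.
  have e2 : (G * S * G * (G * S * G)).trace = ((S * (G * G))ᴴ * (G * G * S)).trace := by
    rw [Matrix.conjTranspose_mul, hG2, hSh.eq]
    calc _ = (G * (S * G * (G * S * G))).trace := by simp only [Matrix.mul_assoc]
      _ = (S * G * (G * S * G) * G).trace := by rw [Matrix.trace_mul_comm]
      _ = (S * (G * G * S * G * G)).trace := by simp only [Matrix.mul_assoc]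
      _ = _ := by rw [Matrix.trace_mul_comm]; simp only [Matrix.mul_assoc]
  rw [e2]
  refine (trace_mul_re_le _ _).trans (le_of_eq ?_)
  have e3 : hsSq (S * (G * G)) = (G * G * (G * G)).trace.re := by
    rw [hsSq_eq_trace, Matrix.conjTranspose_mul, hG2, hSh.eq, Matrix.mul_assoc,
      ← Matrix.mul_assoc S, hSS, Matrix.one_mul]
  have e4 : hsSq (G * G * S) = (G * G * (G * G)).trace.re := by
    rw [hsSq_eq_trace, Matrix.conjTranspose_mul, hG2, hSh.eq, Matrix.trace_mul_comm,
      Matrix.mul_assoc, ← Matrix.mul_assoc S, hSS, Matrix.one_mul]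
  rw [e3, e4, Real.mul_self_sqrt]
  rw [← e3]
  exact hsSq_nonneg _

end TraceNorm

/-! ### Roots of positive matrices, and the smooth divergence as a Hilbert–Schmidt bound -/

section SmoothDivergence

variable {n : Type*} [Fintype n] [DecidableEq n]

/-- The square root of a positive semidefinite matrix. -/
noncomputable def matSqrt (P : Matrix n n ℂ) : Matrix n n ℂ := cfc Real.sqrt P

theorem posSemidef_matSqrt (P : Matrix n n ℂ) : (matSqrt P).PosSemidef :=
  posSemidef_cfc Real.sqrt_nonneg P

theorem matSqrt_mul_self {P : Matrix n n ℂ} (hP : P.PosSemidef) :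
    matSqrt P * matSqrt P = P := by
  have hP' : IsSelfAdjoint P := hP.1
  rw [matSqrt, cfc_mul_matrix, cfc_congr_of_posSemidef hP (fun t ht => Real.mul_self_sqrt ht),
    cfc_id' ℝ P]

/-- Uniqueness of the positive square root; through it, roots factor over Kronecker products. -/
theorem matSqrt_eq_of_mul_self {P Q : Matrix n n ℂ} (hQ : Q.PosSemidef) (h : Q * Q = P) :
    matSqrt P = Q := by
  have hQ' : IsSelfAdjoint Q := hQ.1
  have h' : P = cfc (fun t : ℝ => t * t) Q := by
    rw [← cfc_mul_matrix, cfc_id' ℝ Q, h]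
  rw [matSqrt, h', ← cfc_comp' Real.sqrt (fun t : ℝ => t * t) Q
    (Set.Finite.continuousOn ((Matrix.finite_real_spectrum (A := Q)).image _) _)
    (continuousOn_spectrum Q _),
    cfc_congr_of_posSemidef hQ (fun t ht => Real.sqrt_mul_self ht), cfc_id' ℝ Q]

theorem matSqrt_kronecker {k : Type*} [Fintype k] [DecidableEq k] {P : Matrix n n ℂ}
    {Q : Matrix k k ℂ} (hP : P.PosSemidef) (hQ : Q.PosSemidef) :
    matSqrt (P ⊗ₖ Q) = matSqrt P ⊗ₖ matSqrt Q :=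
  matSqrt_eq_of_mul_self ((posSemidef_matSqrt P).kronecker (posSemidef_matSqrt Q)) (by
    rw [← Matrix.mul_kronecker_mul, matSqrt_mul_self hP, matSqrt_mul_self hQ])

/-- The fourth root of a positive semidefinite matrix. -/
noncomputable def fourthRoot (P : Matrix n n ℂ) : Matrix n n ℂ := matSqrt (matSqrt P)

theorem posSemidef_fourthRoot (P : Matrix n n ℂ) : (fourthRoot P).PosSemidef :=
  posSemidef_matSqrt _

theorem fourthRoot_mul_self (P : Matrix n n ℂ) : fourthRoot P * fourthRoot P = matSqrt P :=
  matSqrt_mul_self (posSemidef_matSqrt P)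

theorem fourthRoot_kronecker {k : Type*} [Fintype k] [DecidableEq k] {P : Matrix n n ℂ}
    {Q : Matrix k k ℂ} (hP : P.PosSemidef) (hQ : Q.PosSemidef) :
    fourthRoot (P ⊗ₖ Q) = fourthRoot P ⊗ₖ fourthRoot Q := by
  rw [fourthRoot, matSqrt_kronecker hP hQ,
    matSqrt_kronecker (posSemidef_matSqrt P) (posSemidef_matSqrt Q), fourthRoot, fourthRoot]

theorem fourthRoot_eq_cfc (P : Matrix n n ℂ) :
    fourthRoot P = cfc (fun t : ℝ => Real.sqrt (Real.sqrt t)) P := by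
  by_cases hP : IsSelfAdjoint P
  · rw [fourthRoot, matSqrt, matSqrt, ← cfc_comp' Real.sqrt Real.sqrt P
      (Set.Finite.continuousOn ((Matrix.finite_real_spectrum (A := P)).image _) _)
      (continuousOn_spectrum P _)]
  -- Outside the self-adjoint matrices `cfc` takes the default value 0, and the root of 0 is 0.
  · have hz : IsSelfAdjoint (0 : Matrix n n ℂ) := IsSelfAdjoint.zero _
    rw [fourthRoot, matSqrt, matSqrt, cfc_apply_of_not_predicate P hP,
      cfc_apply_of_not_predicate P hP, cfc_apply_zero, Real.sqrt_zero, map_zero]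

theorem exists_eq_mul_of_supp_le {ω θ : Matrix n n ℂ} (h : supp ω ≤ supp θ) :
    ∃ Z : Matrix n n ℂ, ω = θ * Z := by
  have hcol : ∀ j, ∃ z : n → ℂ, θ *ᵥ z = ω.col j := fun j => by
    have hj : ω.col j ∈ supp ω := ⟨Pi.single j 1, by simp⟩
    obtain ⟨z, hz⟩ := h hj
    exact ⟨z, by simpa using hz⟩
  choose z hz using hcol
  refine ⟨Matrix.of fun i j => z j i, ?_⟩
  ext i j
  have := congrFun (hz j) i
  rw [Matrix.mul_apply]
  simpa [Matrix.mulVec, dotProduct] using this.symm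

theorem isHermitian_invFourthRoot (θ : Matrix n n ℂ) : (invFourthRoot θ).IsHermitian :=
  isHermitian_cfc _ _

/-- The first two factors multiply to the projection onto the support of θ: t^{1/4} t^{-1/4} is 1
for t > 0, and at t = 0 the factor θ vanishes. -/
theorem fourthRoot_mul_invFourthRoot_mul {θ : Matrix n n ℂ} (hθ : θ.PosSemidef) :
    fourthRoot θ * invFourthRoot θ * θ = θ := by
  have hθ' : IsSelfAdjoint θ := hθ.1
  conv_lhs => rw [fourthRoot_eq_cfc, invFourthRoot, cfc_mul_matrix]
  conv_lhs => rw [← cfc_id' ℝ θ, cfc_id' ℝ θ]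
  nth_rewrite 2 [← cfc_id' ℝ θ]
  rw [cfc_mul_matrix]
  nth_rewrite 2 [← cfc_id' ℝ θ]
  refine cfc_congr_of_posSemidef hθ fun t ht => ?_
  rcases ht.eq_or_lt with rfl | ht
  · simp
  · have : Real.sqrt (Real.sqrt t) * t ^ (-(1 / 4) : ℝ) = 1 := by
      rw [Real.sqrt_eq_rpow, Real.sqrt_eq_rpow, ← Real.rpow_mul ht.le, ← Real.rpow_add ht]
      norm_num
    rw [this, one_mul]

/-- The support projection fixes ω from the left because ω factors through θ, and from the right by
taking adjoints. -/
theorem fourthRoot_mul_conj_invFourthRoot_mul {ω θ : Matrix n n ℂ} (hω : ω.IsHermitian)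
    (hθ : θ.PosSemidef) (h : supp ω ≤ supp θ) :
    fourthRoot θ * (invFourthRoot θ * ω * invFourthRoot θ) * fourthRoot θ = ω := by
  obtain ⟨Z, hZ⟩ := exists_eq_mul_of_supp_le h
  have h1 : fourthRoot θ * invFourthRoot θ * ω = ω := by
    rw [hZ, ← Matrix.mul_assoc, fourthRoot_mul_invFourthRoot_mul hθ]
  have h2 : ω * (invFourthRoot θ * fourthRoot θ) = ω := by
    have := congrArg Matrix.conjTranspose h1
    rwa [Matrix.conjTranspose_mul, Matrix.conjTranspose_mul, hω.eq,
      (isHermitian_invFourthRoot θ).eq, (posSemidef_fourthRoot θ).1.eq] at this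
  calc _ = fourthRoot θ * invFourthRoot θ * ω * (invFourthRoot θ * fourthRoot θ) := by
        simp only [Matrix.mul_assoc]
    _ = ω := by rw [h1, h2]

theorem exists_of_D2_lt {ω θ : Matrix n n ℂ} (hω : ω.IsHermitian) (hθ : θ.PosSemidef) {r : ℝ}
    (h : D2 ω θ < (r : EReal)) :
    ∃ K : Matrix n n ℂ, ω = fourthRoot θ * K * fourthRoot θ ∧
      hsSq K < (2 : ℝ) ^ r := by
  by_cases hs : supp ω ≤ supp θ
  swap
  · rw [D2, if_neg hs] at h
    exact absurd h (not_lt.mpr le_top)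
  refine ⟨invFourthRoot θ * ω * invFourthRoot θ,
    (fourthRoot_mul_conj_invFourthRoot_mul hω hθ hs).symm, ?_⟩
  · rw [D2, if_pos hs] at h
    rw [← hsNorm_sq]
    have h0 : 0 ≤ hsNorm (invFourthRoot θ * ω * invFourthRoot θ) := Real.sqrt_nonneg _
    generalize hsNorm (invFourthRoot θ * ω * invFourthRoot θ) = t at h h0 ⊢
    -- The case of divergence -∞: the norm is 0, below any power of 2.
    split_ifs at h with ht
    · rw [ht, zero_pow two_ne_zero]
      exact Real.rpow_pos_of_pos two_pos r
    · have ht' : 0 < t := lt_of_le_of_ne h0 (Ne.symm ht)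
      rw [EReal.coe_lt_coe_iff] at h
      rw [← Real.logb_lt_iff_lt_rpow one_lt_two (by positivity), Real.logb_pow]
      exact_mod_cast h

/-- The form in which each rate hypothesis is used. The bound is 2 to the power log c + log t - log
ε^{-2}. -/
theorem exists_of_gt_smoothD2 {ε : ℝ} (hε : 0 < ε) {ω θ : Matrix n n ℂ}
    (hθ : θ.PosSemidef) {c t : ℝ} (hc : 0 < c) (ht : 0 < t)
    (h : ((Real.logb 2 c : ℝ) : EReal) >
      smoothD2 ε ω θ - ((Real.logb 2 t : ℝ) : EReal) + ((Real.logb 2 (ε ^ (-2 : ℤ)) : ℝ) : EReal)) :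
    ∃ ω' K : Matrix n n ℂ, ω'.PosSemidef ∧ traceNorm (ω' - ω) ≤ ε * ω.trace.re ∧
      ω' = fourthRoot θ * K * fourthRoot θ ∧ hsSq K < c * t * ε ^ 2 := by
  have h' : smoothD2 ε ω θ <
      ((Real.logb 2 c + Real.logb 2 t - Real.logb 2 (ε ^ (-2 : ℤ)) : ℝ) : EReal) := by
    induction hS : smoothD2 ε ω θ with
    | bot => exact EReal.bot_lt_coe _
    | top =>
      rw [hS, EReal.top_sub_coe, EReal.top_add_coe] at h
      exact absurd h (not_lt.mpr le_top)
    | coe s =>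
      rw [hS, ← EReal.coe_sub, ← EReal.coe_add, gt_iff_lt, EReal.coe_lt_coe_iff] at h
      rw [EReal.coe_lt_coe_iff]
      linarith
  rw [smoothD2] at h'
  -- Strictness yields a state below the bound, so attainment of the minimum is not needed.
  simp only [iInf_lt_iff] at h'
  obtain ⟨ω', ⟨hω', hd⟩, h'⟩ := h'
  obtain ⟨K, hK, hlt⟩ := exists_of_D2_lt hω'.1.1 hθ h'
  refine ⟨ω', K, hω'.1, hd, hK, hlt.trans_eq ?_⟩
  rw [← Real.logb_mul hc.ne' ht.ne', ← Real.logb_div (by positivity) (by positivity),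
    Real.rpow_logb two_pos (by norm_num) (by positivity), _root_.zpow_neg,
    div_inv_eq_mul]
  norm_cast

end SmoothDivergence

/-! ### Vectors placed in one position of a tensor power -/

section OneVariable

variable {P : Type*} [Fintype P]

theorem sum_pi_prod {A : ℕ} (F : Fin A → P → ℂ) :
    ∑ s : Fin A → P, ∏ i, F i (s i) = ∏ i, ∑ p, F i p := by
  classical
  rw [Finset.prod_univ_sum, Fintype.piFinset_univ]

/-- The tensor product of `f` in position `a` and copies of `u` in all other positions. -/
noncomputable def placeVec {A : ℕ} (u f : P → ℂ) (a : Fin A) (s : Fin A → P) : ℂ :=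
  f (s a) * ∏ i ∈ Finset.univ.erase a, u (s i)

theorem placeVec_eq_prod {A : ℕ} (u f : P → ℂ) (a : Fin A) (s : Fin A → P) :
    placeVec u f a s = ∏ i, (if i = a then f else u) (s i) := by
  rw [placeVec, ← Finset.mul_prod_erase _ _ (Finset.mem_univ a), if_pos rfl]
  congr 1
  exact Finset.prod_congr rfl fun i hi => by rw [if_neg (Finset.ne_of_mem_erase hi)]

theorem star_mul_self_eq (z : ℂ) : star z * z = ((‖z‖ ^ 2 : ℝ) : ℂ) := by
  rw [Complex.star_def, Complex.conj_mul', Complex.ofReal_pow]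

theorem sum_star_mul_self (f : P → ℂ) :
    ∑ p, star (f p) * f p = ((∑ p, ‖f p‖ ^ 2 : ℝ) : ℂ) := by
  simp only [star_mul_self_eq, Complex.ofReal_sum]

/-- The inner product factors over positions; for a ≠ a' the position a' contributes ⟨u, f⟩ = 0. -/
theorem sum_star_placeVec_mul {A : ℕ} {u f : P → ℂ} (hu : ∑ p, ‖u p‖ ^ 2 = 1) (a a' : Fin A)
    (h : a = a' ∨ ∑ p, star (u p) * f p = 0) :
    ∑ s, star (placeVec u f a s) * placeVec u f a' s =
      if a = a' then ((∑ p, ‖f p‖ ^ 2 : ℝ) : ℂ) else 0 := by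
  simp only [placeVec_eq_prod, star_prod, ← Finset.prod_mul_distrib]
  rw [sum_pi_prod (fun i p => star ((if i = a then f else u) p) * (if i = a' then f else u) p)]
  split_ifs with haa
  · subst haa
    rw [Finset.prod_eq_single a]
    · simp only [if_true, sum_star_mul_self]
    · intro i _ hi
      simp only [if_neg hi, sum_star_mul_self, hu, Complex.ofReal_one]
    · simp
  · refine Finset.prod_eq_zero (Finset.mem_univ a') ?_
    simp only [if_true, if_neg (Ne.symm haa)]
    exact h.resolve_left haa

theorem sum_norm_placeVec_sq {A : ℕ} {u : P → ℂ} (f : P → ℂ) (hu : ∑ p, ‖u p‖ ^ 2 = 1)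
    (a : Fin A) : ∑ s, ‖placeVec u f a s‖ ^ 2 = ∑ p, ‖f p‖ ^ 2 := by
  have h := sum_star_placeVec_mul (f := f) hu a a (Or.inl rfl)
  rw [sum_star_mul_self, if_pos rfl] at h
  exact_mod_cast h

/-- Pythagoras: orthogonality replaces the factor A² of Cauchy–Schwarz by A. This is the source of
all decoupling. -/
theorem sum_norm_sum_placeVec_sq {A : ℕ} {u f : P → ℂ} (hu : ∑ p, ‖u p‖ ^ 2 = 1)
    (h : ∑ p, star (u p) * f p = 0) :
    ∑ s, ‖∑ a : Fin A, placeVec u f a s‖ ^ 2 = A * ∑ p, ‖f p‖ ^ 2 := by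
  have h1 := sum_star_mul_self (fun s : Fin A → P => ∑ a : Fin A, placeVec u f a s)
  simp only [star_sum, Finset.sum_mul_sum] at h1
  rw [Finset.sum_comm] at h1
  have h2 : ∀ a : Fin A, ∑ s, ∑ a' : Fin A, star (placeVec u f a s) * placeVec u f a' s =
      ((∑ p, ‖f p‖ ^ 2 : ℝ) : ℂ) := fun a => by
    rw [Finset.sum_comm]
    simp only [sum_star_placeVec_mul hu _ _ (Or.inr h), Finset.sum_ite_eq, Finset.mem_univ,
      if_true]
  simp only [h2, Finset.sum_const, Finset.card_univ, Fintype.card_fin, nsmul_eq_mul] at h1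
  exact_mod_cast h1.symm

theorem norm_sum_sq_le {ι : Type*} [Fintype ι] (z : ι → ℂ) :
    ‖∑ a, z a‖ ^ 2 ≤ Fintype.card ι * ∑ a, ‖z a‖ ^ 2 := by
  refine (pow_le_pow_left₀ (norm_nonneg _) (norm_sum_le _ _) 2).trans ?_
  exact sq_sum_le_card_mul_sum_sq

/-- The Cauchy–Schwarz bound, for a register on which no orthogonality is available. -/
theorem sum_norm_sum_placeVec_sq_le {A : ℕ} {u : P → ℂ} (f : P → ℂ)
    (hu : ∑ p, ‖u p‖ ^ 2 = 1) :
    ∑ s, ‖∑ a : Fin A, placeVec u f a s‖ ^ 2 ≤ (A : ℝ) ^ 2 * ∑ p, ‖f p‖ ^ 2 := by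
  calc ∑ s, ‖∑ a : Fin A, placeVec u f a s‖ ^ 2
      ≤ ∑ s, (A : ℝ) * ∑ a : Fin A, ‖placeVec u f a s‖ ^ 2 :=
        Finset.sum_le_sum fun s _ => by simpa using norm_sum_sq_le fun a => placeVec u f a s
    _ = (A : ℝ) ^ 2 * ∑ p, ‖f p‖ ^ 2 := by
        rw [← Finset.mul_sum, Finset.sum_comm]
        simp only [sum_norm_placeVec_sq f hu, Finset.sum_const, Finset.card_univ,
          Fintype.card_fin, nsmul_eq_mul]
        ring

theorem sum_star_mul_sub {u : P → ℂ} (f : P → ℂ) (hu : ∑ p, ‖u p‖ ^ 2 = 1) :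
    ∑ p, star (u p) * (f p - u p * ∑ q, star (u q) * f q) = 0 := by
  have h := sum_star_mul_self u
  rw [hu, Complex.ofReal_one] at h
  simp only [mul_sub, Finset.sum_sub_distrib, ← mul_assoc, ← Finset.sum_mul]
  rw [h, one_mul, sub_self]

theorem sum_norm_sub_sq_le {u : P → ℂ} (f : P → ℂ) (hu : ∑ p, ‖u p‖ ^ 2 = 1) :
    ∑ p, ‖f p - u p * ∑ q, star (u q) * f q‖ ^ 2 ≤ ∑ p, ‖f p‖ ^ 2 := by
  have h := sum_star_mul_sub f hu
  set z := ∑ q, star (u q) * f q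
  -- Pointwise expansion for Pythagoras; the cross terms cancel only after summation over p.
  have h1 : ∀ p, ‖f p‖ ^ 2 = ‖f p - u p * z‖ ^ 2 + ‖u p * z‖ ^ 2 +
      2 * (star z * (star (u p) * (f p - u p * z))).re := fun p => by
    have h2 : f p = (f p - u p * z) + u p * z := by ring
    conv_lhs => rw [h2]
    generalize f p - u p * z = w
    have h3 : (w * star (u p * z)).re = (star z * (star (u p) * w)).re := by
      congr 1
      rw [star_mul]
      ring
    rw [← h3, Complex.sq_norm, Complex.sq_norm, Complex.sq_norm, Complex.normSq_add,
      Complex.star_def]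
  simp only [h1, Finset.sum_add_distrib, ← Finset.mul_sum, ← Complex.re_sum, h, mul_zero,
    Complex.zero_re, add_zero]
  exact le_add_of_nonneg_right (by positivity)

end OneVariable

/-! ### Combining the bounds for the two registers -/

section Spread

variable {P Q R : Type*} [Fintype P] [Fintype Q] [Fintype R]

/-- For fixed T and r, the sum over b is a linear combination over q of the vectors k(·, q, r).
Hence the first-register bound is assumed for all combinations z, and the second-register bound is
applied afterwards. -/
theorem sum_norm_spread_sq_le {A B : ℕ} {u : P → ℂ} {v : Q → ℂ} {k : P → Q → R → ℂ}
    {c d : ℝ} (hc : 0 ≤ c)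
    (hu : ∀ z : Q → ℂ, ∀ r, ∑ S, ‖∑ a : Fin A, placeVec u (fun p => ∑ q, z q * k p q r) a S‖ ^ 2
      ≤ c * ∑ p, ‖∑ q, z q * k p q r‖ ^ 2)
    (hv : ∀ p r, ∑ T, ‖∑ b : Fin B, placeVec v (fun q => k p q r) b T‖ ^ 2
      ≤ d * ∑ q, ‖k p q r‖ ^ 2) :
    ∑ S : Fin A → P, ∑ T : Fin B → Q, ∑ r, ‖∑ a : Fin A, ∑ b : Fin B, k (S a) (T b) r *
      (∏ i ∈ Finset.univ.erase a, u (S i)) * ∏ j ∈ Finset.univ.erase b, v (T j)‖ ^ 2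
      ≤ c * d * ∑ p, ∑ q, ∑ r, ‖k p q r‖ ^ 2 := by
  classical
  have h1 : ∀ (T : Fin B → Q) (r : R), ∑ S : Fin A → P, ‖∑ a : Fin A, ∑ b : Fin B,
      k (S a) (T b) r * (∏ i ∈ Finset.univ.erase a, u (S i)) *
        ∏ j ∈ Finset.univ.erase b, v (T j)‖ ^ 2 ≤
      c * ∑ p, ‖∑ b : Fin B, placeVec v (fun q => k p q r) b T‖ ^ 2 := by
    intro T r
    have h2 : ∀ p, ∑ q, (∑ b : Fin B, if T b = q then
        ∏ j ∈ Finset.univ.erase b, v (T j) else 0) * k p q r =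
        ∑ b : Fin B, placeVec v (fun q => k p q r) b T := fun p => by
      simp only [Finset.sum_mul, ite_mul, zero_mul]
      rw [Finset.sum_comm]
      simp only [Finset.sum_ite_eq, Finset.mem_univ, if_true, placeVec, mul_comm]
    have h3 := hu (fun q => ∑ b : Fin B, if T b = q then
        ∏ j ∈ Finset.univ.erase b, v (T j) else 0) r
    simp only [h2] at h3
    refine le_trans (le_of_eq ?_) h3
    refine Finset.sum_congr rfl fun S _ => ?_
    congr 2
    refine Finset.sum_congr rfl fun a _ => ?_
    simp only [placeVec, Finset.sum_mul]
    exact Finset.sum_congr rfl fun b _ => by ring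
  calc _ = ∑ T : Fin B → Q, ∑ r, ∑ S : Fin A → P, ‖∑ a : Fin A, ∑ b : Fin B,
      k (S a) (T b) r * (∏ i ∈ Finset.univ.erase a, u (S i)) *
        ∏ j ∈ Finset.univ.erase b, v (T j)‖ ^ 2 := by
        rw [Finset.sum_comm]
        exact Finset.sum_congr rfl fun T _ => Finset.sum_comm
    _ ≤ ∑ T : Fin B → Q, ∑ r, c * ∑ p, ‖∑ b : Fin B, placeVec v (fun q => k p q r) b T‖ ^ 2 :=
        Finset.sum_le_sum fun T _ => Finset.sum_le_sum fun r _ => h1 T r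
    _ = c * ∑ p, ∑ r, ∑ T : Fin B → Q, ‖∑ b : Fin B, placeVec v (fun q => k p q r) b T‖ ^ 2 := by
        simp only [← Finset.mul_sum]
        congr 1
        rw [Finset.sum_comm, Finset.sum_comm (s := (Finset.univ : Finset P))]
        refine Finset.sum_congr rfl fun r _ => Finset.sum_comm
    _ ≤ c * ∑ p, ∑ r, d * ∑ q, ‖k p q r‖ ^ 2 := by
        gcongr with p _ r _
        exact hv p r
    _ = _ := by
        simp only [← Finset.mul_sum]
        rw [mul_assoc]
        congr 2
        exact Finset.sum_congr rfl fun p _ => Finset.sum_comm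

end Spread

variable {x y m r : Type*} [Fintype x] [DecidableEq x] [Fintype y] [DecidableEq y]
  [Fintype m] [DecidableEq m] [Fintype r] [DecidableEq r]

/-! ### Reduction of linear identities to product matrices -/

section Kronecker

@[elab_as_elim]
theorem kronecker_induction {p : Matrix (x × r) (x × r) ℂ → Prop} (K : Matrix (x × r) (x × r) ℂ)
    (zero : p 0) (add : ∀ K L, p K → p L → p (K + L)) (kron : ∀ k l, p (k ⊗ₖ l)) : p K := by
  refine Matrix.induction_on' K zero add fun i j z => ?_
  have := kron (Matrix.single i.1 j.1 z) (Matrix.single i.2 j.2 1)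
  rwa [Matrix.single_kronecker_single, mul_one] at this

@[elab_as_elim]
theorem kronecker_induction₃ {p : Matrix (x × y × m) (x × y × m) ℂ → Prop}
    (K : Matrix (x × y × m) (x × y × m) ℂ) (zero : p 0)
    (add : ∀ K L, p K → p L → p (K + L)) (kron : ∀ k l n, p (k ⊗ₖ (l ⊗ₖ n))) : p K := by
  refine kronecker_induction K zero add fun k L => ?_
  refine kronecker_induction (p := fun L => p (k ⊗ₖ L)) L ?_ ?_ (kron k)
  · rwa [Matrix.kronecker_zero]
  · intro L L' h h'
    rw [Matrix.kronecker_add]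
    exact add _ _ h h'

end Kronecker

/-! ### Tensor products of families, placed matrices and the convex split map -/

section PiTensor

/-- The tensor product of a family of matrices. -/
def piTensor {A : ℕ} (F : Fin A → Matrix x x ℂ) : Matrix (Fin A → x) (Fin A → x) ℂ :=
  Matrix.of fun s t => ∏ i, F i (s i) (t i)

theorem piTensor_mul {A : ℕ} (F G : Fin A → Matrix x x ℂ) :
    piTensor F * piTensor G = piTensor fun i => F i * G i := by
  ext s t
  simp only [piTensor, Matrix.mul_apply, Matrix.of_apply, ← Finset.prod_mul_distrib]
  exact sum_pi_prod fun i p => F i (s i) p * G i p (t i)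

theorem trace_piTensor {A : ℕ} (F : Fin A → Matrix x x ℂ) :
    (piTensor F).trace = ∏ i, (F i).trace :=
  sum_pi_prod fun i p => F i p p

end PiTensor

section Placed

variable {A B : ℕ}

theorem placed_kronecker (k u : Matrix x x ℂ) (l v : Matrix y y ℂ) (n : Matrix m m ℂ)
    (a : Fin A) (b : Fin B) :
    placed (k ⊗ₖ (l ⊗ₖ n)) u v a b = piTensor (fun i => if i = a then k else u) ⊗ₖ
      (piTensor (fun j => if j = b then l else v) ⊗ₖ n) := by
  ext s t
  simp only [placed, piTensor, Matrix.of_apply, Matrix.kroneckerMap_apply]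
  have h1 : ∏ i, (if i = a then k else u) (s.1 i) (t.1 i) =
      k (s.1 a) (t.1 a) * ∏ i ∈ Finset.univ.erase a, u (s.1 i) (t.1 i) := by
    rw [← Finset.mul_prod_erase _ _ (Finset.mem_univ a), if_pos rfl]
    congr 1
    exact Finset.prod_congr rfl fun i hi => by rw [if_neg (Finset.ne_of_mem_erase hi)]
  have h2 : ∏ j, (if j = b then l else v) (s.2.1 j) (t.2.1 j) =
      l (s.2.1 b) (t.2.1 b) * ∏ j ∈ Finset.univ.erase b, v (s.2.1 j) (t.2.1 j) := by
    rw [← Finset.mul_prod_erase _ _ (Finset.mem_univ b), if_pos rfl]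
    congr 1
    exact Finset.prod_congr rfl fun j hj => by rw [if_neg (Finset.ne_of_mem_erase hj)]
  rw [h1, h2]
  ring

theorem placed_zero (u : Matrix x x ℂ) (v : Matrix y y ℂ) (a : Fin A) (b : Fin B) :
    placed (0 : Matrix (x × y × m) (x × y × m) ℂ) u v a b = 0 := by
  ext s t
  simp [placed]

theorem placed_add (K L : Matrix (x × y × m) (x × y × m) ℂ) (u : Matrix x x ℂ)
    (v : Matrix y y ℂ) (a : Fin A) (b : Fin B) :
    placed (K + L) u v a b = placed K u v a b + placed L u v a b := by
  ext s t
  simp only [placed, Matrix.of_apply, Matrix.add_apply]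
  ring

theorem placed_smul (z : ℂ) (K : Matrix (x × y × m) (x × y × m) ℂ) (u : Matrix x x ℂ)
    (v : Matrix y y ℂ) (a : Fin A) (b : Fin B) :
    placed (z • K) u v a b = z • placed K u v a b := by
  ext s t
  simp only [placed, Matrix.of_apply, Matrix.smul_apply, smul_eq_mul]
  ring

/-- Both sides are bilinear in K and L, and for product matrices the identity holds position by
position. -/
theorem placed_mul (K L : Matrix (x × y × m) (x × y × m) ℂ) (u u' : Matrix x x ℂ)
    (v v' : Matrix y y ℂ) (a : Fin A) (b : Fin B) :
    placed K u v a b * placed L u' v' a b = placed (K * L) (u * u') (v * v') a b := by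
  refine kronecker_induction₃ K ?_ ?_ fun k l n => ?_
  · simp only [placed_zero, Matrix.zero_mul]
  · intro K K' h h'
    simp only [placed_add, Matrix.add_mul, h, h']
  refine kronecker_induction₃ L ?_ ?_ fun k' l' n' => ?_
  · simp only [placed_zero, Matrix.mul_zero]
  · intro L L' h h'
    simp only [placed_add, Matrix.mul_add, h, h']
  simp only [placed_kronecker, ← Matrix.mul_kronecker_mul, piTensor_mul]
  congr 3
  · funext i
    split_ifs <;> rfl
  · funext i
    split_ifs <;> rfl

theorem trace_placed (K : Matrix (x × y × m) (x × y × m) ℂ) {α : Matrix x x ℂ}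
    {β : Matrix y y ℂ} (hα : α.trace = 1) (hβ : β.trace = 1) (a : Fin A) (b : Fin B) :
    (placed K α β a b).trace = K.trace := by
  refine kronecker_induction₃ K ?_ ?_ fun k l n => ?_
  · simp only [placed_zero, Matrix.trace_zero]
  · intro K L h h'
    simp only [placed_add, Matrix.trace_add, h, h']
  simp only [placed_kronecker, Matrix.trace_kronecker, trace_piTensor]
  rw [Finset.prod_eq_single a, Finset.prod_eq_single b, if_pos rfl, if_pos rfl]
  · intro j _ hj
    rw [if_neg hj, hβ]
  · simp
  · intro i _ hi
    rw [if_neg hi, hα]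
  · simp

theorem conjTranspose_placed (K : Matrix (x × y × m) (x × y × m) ℂ) (u : Matrix x x ℂ)
    (v : Matrix y y ℂ) (a : Fin A) (b : Fin B) :
    (placed K u v a b)ᴴ = placed Kᴴ uᴴ vᴴ a b := by
  ext s t
  simp only [placed, Matrix.of_apply, Matrix.conjTranspose_apply, star_mul', star_prod]

/-- Placement respects products and adjoints, so factorisations CᴴC of the three inputs give one of
the output. -/
theorem posSemidef_placed {K : Matrix (x × y × m) (x × y × m) ℂ} {α : Matrix x x ℂ}
    {β : Matrix y y ℂ} (hK : K.PosSemidef) (hα : α.PosSemidef) (hβ : β.PosSemidef)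
    (a : Fin A) (b : Fin B) : (placed K α β a b).PosSemidef := by
  obtain ⟨C, rfl⟩ := hK.exists_eq_conjTranspose_mul_self
  obtain ⟨U, rfl⟩ := hα.exists_eq_conjTranspose_mul_self
  obtain ⟨V, rfl⟩ := hβ.exists_eq_conjTranspose_mul_self
  rw [← placed_mul, ← conjTranspose_placed]
  exact Matrix.posSemidef_conjTranspose_mul_self _

theorem placed_kronecker_self (u : Matrix x x ℂ) (v : Matrix y y ℂ) (n : Matrix m m ℂ)
    (a : Fin A) (b : Fin B) :
    placed (u ⊗ₖ (v ⊗ₖ n)) u v a b = tensorPow A u ⊗ₖ (tensorPow B v ⊗ₖ n) := by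
  simp only [placed_kronecker, ite_self]
  rfl

/-- The convex split state as a linear function of the state. -/
noncomputable def splitMap (A B : ℕ) (α : Matrix x x ℂ) (β : Matrix y y ℂ) :
    Matrix (x × y × m) (x × y × m) ℂ →ₗ[ℂ]
      Matrix ((Fin A → x) × (Fin B → y) × m) ((Fin A → x) × (Fin B → y) × m) ℂ where
  toFun K := convexSplitState A B K α β
  map_add' K L := by
    simp only [convexSplitState, placed_add, Finset.sum_add_distrib, smul_add]
  map_smul' z K := by
    simp only [convexSplitState, placed_smul, ← Finset.smul_sum, RingHom.id_apply]
    rw [smul_comm]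

theorem splitMap_apply (α : Matrix x x ℂ) (β : Matrix y y ℂ)
    (K : Matrix (x × y × m) (x × y × m) ℂ) :
    splitMap A B α β K = ((A : ℂ) * (B : ℂ))⁻¹ • ∑ a : Fin A, ∑ b : Fin B, placed K α β a b :=
  rfl

theorem posSemidef_splitMap {K : Matrix (x × y × m) (x × y × m) ℂ} {α : Matrix x x ℂ}
    {β : Matrix y y ℂ} (hK : K.PosSemidef) (hα : α.PosSemidef) (hβ : β.PosSemidef) :
    (splitMap A B α β K).PosSemidef := by
  rw [splitMap_apply]
  refine Matrix.PosSemidef.smul (Matrix.posSemidef_sum _ fun a _ =>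
    Matrix.posSemidef_sum _ fun b _ => posSemidef_placed hK hα hβ a b) ?_
  rw [← Nat.cast_mul, ← Complex.ofReal_natCast, ← Complex.ofReal_inv]
  exact Complex.zero_le_real.mpr (by positivity)

theorem trace_splitMap (hA : 0 < A) (hB : 0 < B) (K : Matrix (x × y × m) (x × y × m) ℂ)
    {α : Matrix x x ℂ} {β : Matrix y y ℂ} (hα : α.trace = 1) (hβ : β.trace = 1) :
    (splitMap A B α β K).trace = K.trace := by
  rw [splitMap_apply]
  simp only [Matrix.trace_smul, Matrix.trace_sum, trace_placed K hα hβ, Finset.sum_const,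
    Finset.card_univ, Fintype.card_fin, nsmul_eq_mul, smul_eq_mul]
  have h1 : (A : ℂ) ≠ 0 := Nat.cast_ne_zero.mpr hA.ne'
  have h2 : (B : ℂ) ≠ 0 := Nat.cast_ne_zero.mpr hB.ne'
  field_simp

theorem splitMap_kronecker (hA : 0 < A) (hB : 0 < B) (u : Matrix x x ℂ) (v : Matrix y y ℂ)
    (n : Matrix m m ℂ) :
    splitMap A B u v (u ⊗ₖ (v ⊗ₖ n)) = tensorPow A u ⊗ₖ (tensorPow B v ⊗ₖ n) := by
  rw [splitMap_apply]
  simp only [placed_kronecker_self, Finset.sum_const, Finset.card_univ, Fintype.card_fin]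
  rw [← Nat.cast_smul_eq_nsmul ℂ, ← Nat.cast_smul_eq_nsmul ℂ, smul_smul, smul_smul, mul_assoc,
    inv_mul_cancel₀, one_smul]
  have h1 : (A : ℂ) ≠ 0 := Nat.cast_ne_zero.mpr hA.ne'
  have h2 : (B : ℂ) ≠ 0 := Nat.cast_ne_zero.mpr hB.ne'
  exact mul_ne_zero h1 h2

/-- The conjugating tensor power is the placement of a ⊗ b ⊗ c at every position simultaneously, so
it leaves the sum. It is applied with a = α^{1/4}, u = √α, and similarly for β. -/
theorem splitMap_mul_mul (a u : Matrix x x ℂ) (b v : Matrix y y ℂ) (c : Matrix m m ℂ)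
    (K : Matrix (x × y × m) (x × y × m) ℂ) :
    splitMap A B (a * u * a) (b * v * b) (a ⊗ₖ (b ⊗ₖ c) * K * a ⊗ₖ (b ⊗ₖ c)) =
      tensorPow A a ⊗ₖ (tensorPow B b ⊗ₖ c) * splitMap A B u v K *
        tensorPow A a ⊗ₖ (tensorPow B b ⊗ₖ c) := by
  simp only [splitMap_apply, Matrix.mul_smul, Matrix.smul_mul, Matrix.mul_sum, Matrix.sum_mul,
    ← placed_mul, placed_kronecker_self]

end Placed

/-! ### Hilbert–Schmidt bounds for sums of placed matrices -/

section HilbertSchmidt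

variable {A B : ℕ}

/-- The coefficients of a matrix on `X ⊗ Y ⊗ M`, as a vector in the tensor product of the spaces
of matrices on `X`, `Y` and `M`. -/
def coeffs (K : Matrix (x × y × m) (x × y × m) ℂ) (p : x × x) (q : y × y) (r : m × m) : ℂ :=
  K (p.1, q.1, r.1) (p.2, q.2, r.2)

/-- Pairs of triples as triples of pairs, with pairs of functions as functions to pairs. -/
def pairEquiv (x y m : Type*) (A B : ℕ) :
    ((Fin A → x) × (Fin B → y) × m) × ((Fin A → x) × (Fin B → y) × m) ≃
      (Fin A → x × x) × (Fin B → y × y) × (m × m) where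
  toFun p := (fun i => (p.1.1 i, p.2.1 i), fun j => (p.1.2.1 j, p.2.2.1 j), (p.1.2.2, p.2.2.2))
  invFun p := ((fun i => (p.1 i).1, fun j => (p.2.1 j).1, p.2.2.1),
    (fun i => (p.1 i).2, fun j => (p.2.1 j).2, p.2.2.2))
  left_inv _ := rfl
  right_inv _ := rfl

/-- Pairs of triples as triples of pairs. -/
def pairEquiv₁ (x y m : Type*) : (x × y × m) × (x × y × m) ≃ (x × x) × (y × y) × (m × m) where
  toFun p := ((p.1.1, p.2.1), (p.1.2.1, p.2.2.1), (p.1.2.2, p.2.2.2))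
  invFun p := ((p.1.1, p.2.1.1, p.2.2.1), (p.1.2, p.2.1.2, p.2.2.2))
  left_inv _ := rfl
  right_inv _ := rfl

theorem hsSq_eq_sum_coeffs (K : Matrix (x × y × m) (x × y × m) ℂ) :
    hsSq K = ∑ p, ∑ q, ∑ r, ‖coeffs K p q r‖ ^ 2 := by
  rw [hsSq, ← Fintype.sum_prod_type']
  simp only [← Fintype.sum_prod_type']
  exact Fintype.sum_equiv (pairEquiv₁ x y m) _ _ fun _ => rfl

theorem hsSq_sum_placed (K : Matrix (x × y × m) (x × y × m) ℂ) (u : Matrix x x ℂ)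
    (v : Matrix y y ℂ) :
    hsSq (∑ a : Fin A, ∑ b : Fin B, placed K u v a b) =
      ∑ S : Fin A → x × x, ∑ T : Fin B → y × y, ∑ r, ‖∑ a : Fin A, ∑ b : Fin B,
        coeffs K (S a) (T b) r * (∏ i ∈ Finset.univ.erase a, u (S i).1 (S i).2) *
          ∏ j ∈ Finset.univ.erase b, v (T j).1 (T j).2‖ ^ 2 := by
  rw [hsSq, ← Fintype.sum_prod_type']
  simp only [← Fintype.sum_prod_type']
  refine Fintype.sum_equiv (pairEquiv x y m A B) _ _ fun p => ?_
  simp only [Matrix.sum_apply]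
  rfl

theorem sum_norm_entries_sq {u : Matrix x x ℂ} :
    ∑ p : x × x, ‖u p.1 p.2‖ ^ 2 = hsSq u := by
  rw [hsSq, ← Fintype.sum_prod_type']

variable {K : Matrix (x × y × m) (x × y × m) ℂ} {u : Matrix x x ℂ} {v : Matrix y y ℂ}

theorem sum_star_mul_sum_eq_zero
    (hK : ∀ q r, ∑ p : x × x, star (u p.1 p.2) * coeffs K p q r = 0) (z : y × y → ℂ) (r : m × m) :
    ∑ p : x × x, star (u p.1 p.2) * ∑ q, z q * coeffs K p q r = 0 := by
  simp only [Finset.mul_sum]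
  rw [Finset.sum_comm]
  refine Finset.sum_eq_zero fun q _ => ?_
  simp only [mul_left_comm _ (z q), ← Finset.mul_sum, hK, mul_zero]

/-- Pythagoras in both registers; the two one-sided variants below pay a square in the other
register. -/
theorem hsSq_sum_placed_le_of_orthogonal (hu : hsSq u = 1) (hv : hsSq v = 1)
    (hK : ∀ q r, ∑ p : x × x, star (u p.1 p.2) * coeffs K p q r = 0)
    (hK' : ∀ p r, ∑ q : y × y, star (v q.1 q.2) * coeffs K p q r = 0) :
    hsSq (∑ a : Fin A, ∑ b : Fin B, placed K u v a b) ≤ A * B * hsSq K := by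
  rw [← sum_norm_entries_sq] at hu hv
  rw [hsSq_sum_placed, hsSq_eq_sum_coeffs]
  exact sum_norm_spread_sq_le (u := fun p : x × x => u p.1 p.2) (v := fun q : y × y => v q.1 q.2)
    (Nat.cast_nonneg A)
    (fun z r => (sum_norm_sum_placeVec_sq hu (sum_star_mul_sum_eq_zero hK z r)).le)
    (fun p r => (sum_norm_sum_placeVec_sq hv (hK' p r)).le)

theorem hsSq_sum_placed_le_of_orthogonal_left (hu : hsSq u = 1) (hv : hsSq v = 1)
    (hK : ∀ q r, ∑ p : x × x, star (u p.1 p.2) * coeffs K p q r = 0) :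
    hsSq (∑ a : Fin A, ∑ b : Fin B, placed K u v a b) ≤ A * (B : ℝ) ^ 2 * hsSq K := by
  rw [← sum_norm_entries_sq] at hu hv
  rw [hsSq_sum_placed, hsSq_eq_sum_coeffs]
  exact sum_norm_spread_sq_le (u := fun p : x × x => u p.1 p.2) (v := fun q : y × y => v q.1 q.2)
    (Nat.cast_nonneg A)
    (fun z r => (sum_norm_sum_placeVec_sq hu (sum_star_mul_sum_eq_zero hK z r)).le)
    (fun p r => sum_norm_sum_placeVec_sq_le _ hv)

theorem hsSq_sum_placed_le_of_orthogonal_right (hu : hsSq u = 1) (hv : hsSq v = 1)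
    (hK' : ∀ p r, ∑ q : y × y, star (v q.1 q.2) * coeffs K p q r = 0) :
    hsSq (∑ a : Fin A, ∑ b : Fin B, placed K u v a b) ≤ (A : ℝ) ^ 2 * B * hsSq K := by
  rw [← sum_norm_entries_sq] at hu hv
  rw [hsSq_sum_placed, hsSq_eq_sum_coeffs]
  exact sum_norm_spread_sq_le (u := fun p : x × x => u p.1 p.2) (v := fun q : y × y => v q.1 q.2)
    (sq_nonneg (A : ℝ))
    (fun z r => sum_norm_sum_placeVec_sq_le _ hu)
    (fun p r => (sum_norm_sum_placeVec_sq hv (hK' p r)).le)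

end HilbertSchmidt

/-! ### Replacing or inserting a tensor factor -/

section Replace

/-- The map `K ↦ w ⊗ Tr_X (t K)`. -/
def replaceFst (t w : Matrix x x ℂ) : Matrix (x × r) (x × r) ℂ →ₗ[ℂ] Matrix (x × r) (x × r) ℂ where
  toFun K := Matrix.of fun i j => w i.1 j.1 * ∑ p : x × x, t p.2 p.1 * K (p.1, i.2) (p.2, j.2)
  map_add' K L := by
    ext i j
    simp only [Matrix.of_apply, Matrix.add_apply, mul_add, Finset.sum_add_distrib]
  map_smul' z K := by
    ext i j
    simp only [Matrix.of_apply, Matrix.smul_apply, smul_eq_mul, RingHom.id_apply,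
      mul_left_comm _ z, ← Finset.mul_sum]

theorem replaceFst_apply (t w : Matrix x x ℂ) (K : Matrix (x × r) (x × r) ℂ) (i j : x × r) :
    replaceFst t w K i j = w i.1 j.1 * ∑ p : x × x, t p.2 p.1 * K (p.1, i.2) (p.2, j.2) := rfl

theorem replaceFst_kronecker (t w k : Matrix x x ℂ) (l : Matrix r r ℂ) :
    replaceFst t w (k ⊗ₖ l) = (t * k).trace • (w ⊗ₖ l) := by
  ext i j
  have h : (t * k).trace = ∑ p : x × x, t p.2 p.1 * k p.1 p.2 := by
    rw [Fintype.sum_prod_type, Finset.sum_comm]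
    rfl
  simp only [replaceFst_apply, Matrix.smul_apply, Matrix.kroneckerMap_apply, smul_eq_mul, h,
    ← mul_assoc, ← Finset.sum_mul]
  ring

/-- By cyclicity Tr(aka) = Tr(a²k). For a = α^{1/4}, w = √α this turns K ↦ α ⊗ Tr_X K into K ↦ √α ⊗
Tr_X(√α K), the orthogonal projection along the unit vector √α. -/
theorem replaceFst_mul_mul (a w : Matrix x x ℂ) (c : Matrix r r ℂ)
    (K : Matrix (x × r) (x × r) ℂ) :
    replaceFst 1 (a * w * a) (a ⊗ₖ c * K * a ⊗ₖ c) =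
      a ⊗ₖ c * replaceFst (a * a) w K * a ⊗ₖ c := by
  induction K using kronecker_induction with
  | zero => simp only [Matrix.mul_zero, Matrix.zero_mul, map_zero]
  | add K L h h' => simp only [Matrix.mul_add, Matrix.add_mul, map_add, h, h']
  | kron k l =>
    simp only [← Matrix.mul_kronecker_mul, replaceFst_kronecker, Matrix.mul_smul,
      Matrix.smul_mul, Matrix.one_mul]
    congr 1
    rw [Matrix.trace_mul_comm, Matrix.mul_assoc]

/-- The partial trace over the first factor. -/
def traceFst (K : Matrix (x × r) (x × r) ℂ) : Matrix r r ℂ :=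
  ∑ p : x, K.submatrix (fun i => (p, i)) (fun i => (p, i))

theorem posSemidef_traceFst {K : Matrix (x × r) (x × r) ℂ} (hK : K.PosSemidef) :
    (traceFst K).PosSemidef :=
  Matrix.posSemidef_sum _ fun _ _ => hK.submatrix _

theorem trace_traceFst (K : Matrix (x × r) (x × r) ℂ) : (traceFst K).trace = K.trace := by
  rw [traceFst, Matrix.trace_sum]
  simp only [Matrix.trace, Fintype.sum_prod_type]
  rfl

theorem replaceFst_one (α : Matrix x x ℂ) (K : Matrix (x × r) (x × r) ℂ) :
    replaceFst 1 α K = α ⊗ₖ traceFst K := by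
  ext i j
  simp only [replaceFst_apply, Matrix.kroneckerMap_apply, traceFst, Matrix.sum_apply,
    Matrix.submatrix_apply, Fintype.sum_prod_type, Matrix.one_apply, ite_mul, one_mul, zero_mul,
    Finset.sum_ite_eq', Finset.mem_univ, if_true]

/-- Exchange of the first two tensor factors. -/
def swapEquiv (x y m : Type*) : y × x × m ≃ x × y × m where
  toFun p := (p.2.1, p.1, p.2.2)
  invFun p := (p.2.1, p.1, p.2.2)
  left_inv _ := rfl
  right_inv _ := rfl

/-- The map exchanging the first two tensor factors. -/
def swap (K : Matrix (x × y × m) (x × y × m) ℂ) : Matrix (y × x × m) (y × x × m) ℂ :=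
  K.submatrix (swapEquiv x y m) (swapEquiv x y m)

theorem swap_mul (K L : Matrix (x × y × m) (x × y × m) ℂ) : swap (K * L) = swap K * swap L :=
  (Matrix.submatrix_mul_equiv K L _ (swapEquiv x y m) _).symm

theorem trace_swap (K : Matrix (x × y × m) (x × y × m) ℂ) : (swap K).trace = K.trace :=
  Fintype.sum_equiv (swapEquiv x y m) _ _ fun _ => rfl

theorem hsSq_swap (K : Matrix (x × y × m) (x × y × m) ℂ) : hsSq (swap K) = hsSq K :=
  Fintype.sum_equiv (swapEquiv x y m) _ _ fun _ => Fintype.sum_equiv (swapEquiv x y m) _ _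
    fun _ => rfl

theorem swap_kronecker (k : Matrix x x ℂ) (l : Matrix y y ℂ) (n : Matrix m m ℂ) :
    swap (k ⊗ₖ (l ⊗ₖ n)) = l ⊗ₖ (k ⊗ₖ n) := by
  ext i j
  exact mul_left_comm _ _ _

/-- The map `K ↦ w ⊗ Tr_Y (t K)` on `X ⊗ Y ⊗ M`, with `w` on `Y`. -/
def replaceSnd (t w : Matrix y y ℂ) :
    Matrix (x × y × m) (x × y × m) ℂ →ₗ[ℂ] Matrix (x × y × m) (x × y × m) ℂ where
  toFun K := swap (replaceFst t w (swap K))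
  map_add' K L := by
    rw [show swap (K + L) = swap K + swap L from rfl, map_add]
    rfl
  map_smul' z K := by
    rw [show swap (z • K) = z • swap K from rfl, map_smul]
    rfl

theorem replaceSnd_apply (t w : Matrix y y ℂ) (K : Matrix (x × y × m) (x × y × m) ℂ) :
    replaceSnd t w K = swap (replaceFst t w (swap K)) := rfl

theorem replaceSnd_mul_mul (a : Matrix x x ℂ) (b w : Matrix y y ℂ) (c : Matrix m m ℂ)
    (K : Matrix (x × y × m) (x × y × m) ℂ) :
    replaceSnd 1 (b * w * b) (a ⊗ₖ (b ⊗ₖ c) * K * a ⊗ₖ (b ⊗ₖ c)) =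
      a ⊗ₖ (b ⊗ₖ c) * replaceSnd (b * b) w K * a ⊗ₖ (b ⊗ₖ c) := by
  simp only [replaceSnd_apply, swap_mul, swap_kronecker, replaceFst_mul_mul]

/-- The map inserting `w` on `Y` into a matrix on `X ⊗ M`. -/
def insertSnd (w : Matrix y y ℂ) :
    Matrix (x × m) (x × m) ℂ →ₗ[ℂ] Matrix (x × y × m) (x × y × m) ℂ where
  toFun K := swap (w ⊗ₖ K)
  map_add' K L := by
    rw [Matrix.kronecker_add]
    rfl
  map_smul' z K := by
    rw [Matrix.kronecker_smul]
    rfl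

theorem insertSnd_apply (w : Matrix y y ℂ) (K : Matrix (x × m) (x × m) ℂ) :
    insertSnd w K = swap (w ⊗ₖ K) := rfl

/-- The map inserting `w` on `X` into a matrix on the remaining factors. -/
def insertFst (w : Matrix x x ℂ) : Matrix r r ℂ →ₗ[ℂ] Matrix (x × r) (x × r) ℂ where
  toFun K := w ⊗ₖ K
  map_add' K L := Matrix.kronecker_add w K L
  map_smul' z K := Matrix.kronecker_smul z w K

theorem insertFst_apply (w : Matrix x x ℂ) (K : Matrix r r ℂ) : insertFst w K = w ⊗ₖ K := rfl

theorem insertFst_mul_mul (a w : Matrix x x ℂ) (c K : Matrix r r ℂ) :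
    insertFst (a * w * a) (c * K * c) = a ⊗ₖ c * insertFst w K * a ⊗ₖ c := by
  simp only [insertFst_apply, Matrix.mul_kronecker_mul]

theorem insertSnd_mul_mul (a : Matrix x x ℂ) (b w : Matrix y y ℂ) (c : Matrix m m ℂ)
    (K : Matrix (x × m) (x × m) ℂ) :
    insertSnd (b * w * b) (a ⊗ₖ c * K * a ⊗ₖ c) =
      a ⊗ₖ (b ⊗ₖ c) * insertSnd w K * a ⊗ₖ (b ⊗ₖ c) := by
  simp only [insertSnd_apply, Matrix.mul_kronecker_mul, swap_mul, swap_kronecker]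

theorem hsSq_kronecker (k : Matrix x x ℂ) (l : Matrix r r ℂ) :
    hsSq (k ⊗ₖ l) = hsSq k * hsSq l := by
  simp only [hsSq, Fintype.sum_prod_type, Matrix.kroneckerMap_apply, norm_mul, mul_pow,
    ← Finset.mul_sum, ← Finset.sum_mul]

end Replace

/-! ### Stability of trace bounds under the channels -/

section TraceBounded

variable {c : ℝ}

theorem TraceBounded.insertFst {α : Matrix x x ℂ} (hα : IsDensity α) {T : Matrix r r ℂ}
    (h : TraceBounded T c) : TraceBounded (insertFst α T) c :=
  h.map _ (fun _ hP => hα.1.kronecker hP) fun P => by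
    rw [insertFst_apply, Matrix.trace_kronecker, hα.2, one_mul]

theorem TraceBounded.insertSnd {β : Matrix y y ℂ} (hβ : IsDensity β)
    {T : Matrix (x × m) (x × m) ℂ} (h : TraceBounded T c) : TraceBounded (insertSnd β T) c :=
  h.map _ (fun _ hP => (hβ.1.kronecker hP).submatrix _) fun P => by
    rw [insertSnd_apply, trace_swap, Matrix.trace_kronecker, hβ.2, one_mul]

theorem TraceBounded.replaceFst {α : Matrix x x ℂ} (hα : IsDensity α)
    {T : Matrix (x × r) (x × r) ℂ} (h : TraceBounded T c) :
    TraceBounded (replaceFst 1 α T) c :=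
  h.map _ (fun _ hP => by
    rw [replaceFst_one]
    exact hα.1.kronecker (posSemidef_traceFst hP)) fun P => by
    rw [replaceFst_one, Matrix.trace_kronecker, hα.2, one_mul, trace_traceFst]

theorem TraceBounded.swap {T : Matrix (x × y × m) (x × y × m) ℂ} (h : TraceBounded T c) :
    TraceBounded (swap T) c := by
  obtain ⟨P, Q, hP, hQ, rfl, h⟩ := h
  exact ⟨_, _, hP.submatrix (swapEquiv x y m), hQ.submatrix (swapEquiv x y m), rfl,
    by rwa [← trace_swap P, ← trace_swap Q] at h⟩

theorem TraceBounded.replaceSnd {β : Matrix y y ℂ} (hβ : IsDensity β)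
    {T : Matrix (x × y × m) (x × y × m) ℂ} (h : TraceBounded T c) :
    TraceBounded (replaceSnd 1 β T) c :=
  (h.swap.replaceFst hβ).swap

theorem TraceBounded.splitMap {A B : ℕ} (hA : 0 < A) (hB : 0 < B) {α : Matrix x x ℂ}
    (hα : IsDensity α) {β : Matrix y y ℂ} (hβ : IsDensity β)
    {T : Matrix (x × y × m) (x × y × m) ℂ} (h : TraceBounded T c) :
    TraceBounded (splitMap A B α β T) c :=
  h.map _ (fun _ hP => posSemidef_splitMap hP hα.1 hβ.1) fun P =>
    trace_splitMap hA hB P hα.2 hβ.2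

end TraceBounded

/-! ### Orthogonality after removing the projections -/

section Orthogonality

variable {u : Matrix x x ℂ} {v : Matrix y y ℂ}

theorem coeffs_sub_replaceFst (hu : u.IsHermitian) (K : Matrix (x × y × m) (x × y × m) ℂ)
    (p : x × x) (q : y × y) (r : m × m) :
    coeffs (K - replaceFst u u K) p q r =
      coeffs K p q r - u p.1 p.2 * ∑ p' : x × x, star (u p'.1 p'.2) * coeffs K p' q r := by
  simp only [hu.apply]
  rfl

theorem coeffs_sub_replaceSnd (hv : v.IsHermitian) (K : Matrix (x × y × m) (x × y × m) ℂ)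
    (p : x × x) (q : y × y) (r : m × m) :
    coeffs (K - replaceSnd v v K) p q r =
      coeffs K p q r - v q.1 q.2 * ∑ q' : y × y, star (v q'.1 q'.2) * coeffs K p q' r := by
  simp only [hv.apply]
  rfl

theorem orthogonal_sub_replaceFst (hu : u.IsHermitian) (hu1 : hsSq u = 1)
    (K : Matrix (x × y × m) (x × y × m) ℂ) (q : y × y) (r : m × m) :
    ∑ p : x × x, star (u p.1 p.2) * coeffs (K - replaceFst u u K) p q r = 0 := by
  rw [← sum_norm_entries_sq] at hu1
  simp only [coeffs_sub_replaceFst hu]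
  exact sum_star_mul_sub (u := fun p : x × x => u p.1 p.2) _ hu1

theorem orthogonal_sub_replaceSnd (hv : v.IsHermitian) (hv1 : hsSq v = 1)
    (K : Matrix (x × y × m) (x × y × m) ℂ) (p : x × x) (r : m × m) :
    ∑ q : y × y, star (v q.1 q.2) * coeffs (K - replaceSnd v v K) p q r = 0 := by
  rw [← sum_norm_entries_sq] at hv1
  simp only [coeffs_sub_replaceSnd hv]
  exact sum_star_mul_sub (u := fun q : y × y => v q.1 q.2) _ hv1

/-- The Y-projection acts on the other factor, so it preserves orthogonality already gained on X. -/
theorem orthogonal_fst_sub_replaceSnd (hv : v.IsHermitian)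
    {K : Matrix (x × y × m) (x × y × m) ℂ}
    (hK : ∀ q r, ∑ p : x × x, star (u p.1 p.2) * coeffs K p q r = 0) (q : y × y) (r : m × m) :
    ∑ p : x × x, star (u p.1 p.2) * coeffs (K - replaceSnd v v K) p q r = 0 := by
  simp only [coeffs_sub_replaceSnd hv, mul_sub, Finset.sum_sub_distrib, hK, zero_sub,
    neg_eq_zero, Finset.mul_sum]
  rw [Finset.sum_comm]
  refine Finset.sum_eq_zero fun q' _ => ?_
  calc _ = v q.1 q.2 * star (v q'.1 q'.2) *
      ∑ p : x × x, star (u p.1 p.2) * coeffs K p q' r := by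
        rw [Finset.mul_sum]
        exact Finset.sum_congr rfl fun p _ => by ring
    _ = 0 := by rw [hK, mul_zero]

theorem hsSq_sub_replaceFst_le (hu : u.IsHermitian) (hu1 : hsSq u = 1)
    (K : Matrix (x × y × m) (x × y × m) ℂ) : hsSq (K - replaceFst u u K) ≤ hsSq K := by
  rw [← sum_norm_entries_sq] at hu1
  rw [hsSq_eq_sum_coeffs, hsSq_eq_sum_coeffs, Finset.sum_comm,
    Finset.sum_comm (s := (Finset.univ : Finset (x × x)))]
  refine Finset.sum_le_sum fun q _ => ?_
  rw [Finset.sum_comm, Finset.sum_comm (s := (Finset.univ : Finset (x × x)))]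
  refine Finset.sum_le_sum fun r _ => ?_
  simp only [coeffs_sub_replaceFst hu]
  exact sum_norm_sub_sq_le (u := fun p : x × x => u p.1 p.2) _ hu1

theorem hsSq_sub_replaceSnd_le (hv : v.IsHermitian) (hv1 : hsSq v = 1)
    (K : Matrix (x × y × m) (x × y × m) ℂ) : hsSq (K - replaceSnd v v K) ≤ hsSq K := by
  rw [← hsSq_swap, ← hsSq_swap K]
  exact hsSq_sub_replaceFst_le hv hv1 (swap K)

end Orthogonality

/-! ### Marginals as partial traces -/

section Marginals

variable (ρ : Matrix (x × y × m) (x × y × m) ℂ)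

theorem traceFst_eq_margYM : traceFst ρ = margYM ρ := by
  ext i j
  simp only [traceFst, Matrix.sum_apply, Matrix.submatrix_apply, margYM, Matrix.of_apply]

theorem traceFst_swap_eq_margXM : traceFst (swap ρ) = margXM ρ := by
  ext i j
  simp only [traceFst, Matrix.sum_apply, margXM, Matrix.of_apply]
  rfl

theorem traceFst_margXM : traceFst (margXM ρ) = margM ρ := by
  ext i j
  simp only [traceFst, Matrix.sum_apply, Matrix.submatrix_apply, margXM, margM, Matrix.of_apply]

theorem replaceFst_one_eq (α : Matrix x x ℂ) : replaceFst 1 α ρ = insertFst α (margYM ρ) := by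
  rw [replaceFst_one, traceFst_eq_margYM, insertFst_apply]

theorem replaceSnd_one_eq (β : Matrix y y ℂ) : replaceSnd 1 β ρ = insertSnd β (margXM ρ) := by
  rw [replaceSnd_apply, replaceFst_one, traceFst_swap_eq_margXM, insertSnd_apply]

theorem replaceFst_replaceSnd_one (α : Matrix x x ℂ) (β : Matrix y y ℂ) :
    replaceFst 1 α (replaceSnd 1 β ρ) = α ⊗ₖ (β ⊗ₖ margM ρ) := by
  rw [replaceSnd_one_eq, ← traceFst_margXM, insertSnd_apply]
  generalize margXM ρ = ω
  induction ω using kronecker_induction with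
  | zero =>
    have : traceFst (0 : Matrix (x × m) (x × m) ℂ) = 0 := by
      ext; simp [traceFst, Matrix.sum_apply]
    rw [Matrix.kronecker_zero, this, Matrix.kronecker_zero, Matrix.kronecker_zero]
    exact map_zero _
  | add K L h h' =>
    have : traceFst (K + L) = traceFst K + traceFst L := by
      ext; simp [traceFst, Matrix.sum_apply, Finset.sum_add_distrib]
    rw [this, Matrix.kronecker_add, Matrix.kronecker_add, Matrix.kronecker_add, ← h, ← h',
      ← map_add]
    rfl
  | kron k l =>
    have : traceFst (k ⊗ₖ l) = k.trace • l := by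
      ext i j
      simp [traceFst, Matrix.sum_apply, Matrix.trace, Finset.sum_mul]
    rw [swap_kronecker, replaceFst_kronecker, this, Matrix.one_mul, Matrix.kronecker_smul,
      Matrix.kronecker_smul]

variable {ρ}

theorem posSemidef_margM (hρ : ρ.PosSemidef) : (margM ρ).PosSemidef := by
  rw [← traceFst_margXM, ← traceFst_swap_eq_margXM]
  exact posSemidef_traceFst (posSemidef_traceFst (hρ.submatrix _))

theorem posSemidef_margXM (hρ : ρ.PosSemidef) : (margXM ρ).PosSemidef := by
  rw [← traceFst_swap_eq_margXM]
  exact posSemidef_traceFst (hρ.submatrix _)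

theorem posSemidef_margYM (hρ : ρ.PosSemidef) : (margYM ρ).PosSemidef := by
  rw [← traceFst_eq_margYM]
  exact posSemidef_traceFst hρ

variable (ρ)

theorem trace_margXM : (margXM ρ).trace = ρ.trace := by
  rw [← traceFst_swap_eq_margXM, trace_traceFst, trace_swap]

theorem trace_margYM : (margYM ρ).trace = ρ.trace := by
  rw [← traceFst_eq_margYM, trace_traceFst]

theorem trace_margM : (margM ρ).trace = ρ.trace := by
  rw [← traceFst_margXM, trace_traceFst, trace_margXM]

end Marginals

/-! ### Trace-norm bounds for the three pieces -/

section Bounds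

variable {A B : ℕ} {α : Matrix x x ℂ} {β : Matrix y y ℂ} {θ : Matrix m m ℂ} {t ε : ℝ}

theorem fourthRoot_mul_matSqrt_mul {P : Matrix r r ℂ} (hP : P.PosSemidef) :
    fourthRoot P * matSqrt P * fourthRoot P = P := by
  rw [← fourthRoot_mul_self, Matrix.mul_assoc, Matrix.mul_assoc, ← Matrix.mul_assoc,
    fourthRoot_mul_self, matSqrt_mul_self hP]

theorem hsSq_matSqrt {P : Matrix r r ℂ} (hP : IsDensity P) : hsSq (matSqrt P) = 1 := by
  rw [hsSq_eq_trace, (posSemidef_matSqrt P).1.eq, matSqrt_mul_self hP.1, hP.2, Complex.one_re]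

theorem isHermitian_kronecker {P : Matrix x x ℂ} {Q : Matrix r r ℂ} (hP : P.IsHermitian)
    (hQ : Q.IsHermitian) : (P ⊗ₖ Q).IsHermitian := by
  rw [Matrix.IsHermitian, Matrix.conjTranspose_kronecker, hP.eq, hQ.eq]

theorem isHermitian_tensorPow {P : Matrix x x ℂ} (hP : P.IsHermitian) :
    (tensorPow A P).IsHermitian := by
  ext s t
  simp only [tensorPow, Matrix.conjTranspose_apply, Matrix.of_apply, star_prod, hP.apply]

/-- The fourth root of `α ⊗ β ⊗ θ`. -/
noncomputable def root (α : Matrix x x ℂ) (β : Matrix y y ℂ) (θ : Matrix m m ℂ) :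
    Matrix (x × y × m) (x × y × m) ℂ :=
  fourthRoot α ⊗ₖ (fourthRoot β ⊗ₖ fourthRoot θ)

/-- Hölder with G the fourth root of α^{⊗A} ⊗ β^{⊗B} ⊗ θ. Since Tr G⁴ = t, the bound is √t · √(ε²t),
the prefactor (AB)^{-2} having cancelled (AB)². -/
theorem traceNorm_splitMap_le (hA : 0 < A) (hB : 0 < B) (hα : IsDensity α) (hβ : IsDensity β)
    (hθ : θ.PosSemidef) (ht : θ.trace.re = t) (hε : 0 ≤ ε)
    {K : Matrix (x × y × m) (x × y × m) ℂ}
    (hH : (splitMap A B α β (root α β θ * K * root α β θ)).IsHermitian)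
    (hK : hsSq (∑ a : Fin A, ∑ b : Fin B, placed K (matSqrt α) (matSqrt β) a b) ≤
      (A * B * ε) ^ 2 * t) :
    traceNorm (splitMap A B α β (root α β θ * K * root α β θ)) ≤ ε * t := by
  have hA' : (0 : ℝ) < A := Nat.cast_pos.mpr hA
  have hB' : (0 : ℝ) < B := Nat.cast_pos.mpr hB
  have ht0 : 0 ≤ t := ht ▸ (Complex.nonneg_iff.mp hθ.trace_nonneg).1
  have h1 := splitMap_mul_mul (A := A) (B := B) (fourthRoot α) (matSqrt α) (fourthRoot β)
    (matSqrt β) (fourthRoot θ) K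
  rw [fourthRoot_mul_matSqrt_mul hα.1, fourthRoot_mul_matSqrt_mul hβ.1] at h1
  rw [root] at hH ⊢
  rw [h1] at hH ⊢
  set G := tensorPow A (fourthRoot α) ⊗ₖ (tensorPow B (fourthRoot β) ⊗ₖ fourthRoot θ) with hG
  have hGh : G.IsHermitian := isHermitian_kronecker
    (isHermitian_tensorPow (posSemidef_fourthRoot α).1)
    (isHermitian_kronecker (isHermitian_tensorPow (posSemidef_fourthRoot β).1)
      (posSemidef_fourthRoot θ).1)
  have hG4 : (G * G * (G * G)).trace.re = t := by
    rw [hG, ← placed_kronecker_self _ _ _ (⟨0, hA⟩ : Fin A) (⟨0, hB⟩ : Fin B), placed_mul,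
      placed_mul]
    simp only [← Matrix.mul_kronecker_mul, fourthRoot_mul_self]
    rw [matSqrt_mul_self hα.1, matSqrt_mul_self hβ.1, matSqrt_mul_self hθ,
      trace_placed _ hα.2 hβ.2, Matrix.trace_kronecker, Matrix.trace_kronecker, hα.2, hβ.2,
      one_mul, one_mul, ht]
  refine (traceNorm_mul_mul_le hGh hH).trans ?_
  rw [hG4, splitMap_apply, hsSq_smul]
  have h2 : ‖((A : ℂ) * (B : ℂ))⁻¹‖ ^ 2 *
      hsSq (∑ a : Fin A, ∑ b : Fin B, placed K (matSqrt α) (matSqrt β) a b) ≤ ε ^ 2 * t := by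
    refine (mul_le_mul_of_nonneg_left hK (by positivity)).trans (le_of_eq ?_)
    rw [norm_inv, norm_mul, Complex.norm_natCast, Complex.norm_natCast]
    field_simp
  calc _ ≤ Real.sqrt t * Real.sqrt (ε ^ 2 * t) := by gcongr
    _ = ε * t := by
      rw [Real.sqrt_mul (sq_nonneg ε), Real.sqrt_sq hε, mul_left_comm, Real.mul_self_sqrt ht0]

theorem TraceBounded.of_posSemidef {P : Matrix r r ℂ} (hP : P.PosSemidef) :
    TraceBounded P P.trace.re :=
  ⟨P, 0, hP, Matrix.PosSemidef.zero, by rw [sub_zero], by simp⟩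

/-- Orthogonality in both registers costs only AB, which with ‖K‖₂² ≤ AB t ε² gives the (ABε)² t
required by `traceNorm_splitMap_le`. -/
theorem traceBounded_splitMap_sub_sub (hA : 0 < A) (hB : 0 < B) (hα : IsDensity α)
    (hβ : IsDensity β) (hθ : θ.PosSemidef) (ht : θ.trace.re = t) (hε : 0 ≤ ε)
    {ω K : Matrix (x × y × m) (x × y × m) ℂ} (hω : ω.PosSemidef)
    (hωK : ω = fourthRoot (α ⊗ₖ (β ⊗ₖ θ)) * K * fourthRoot (α ⊗ₖ (β ⊗ₖ θ)))
    (hK : hsSq K ≤ A * B * t * ε ^ 2) :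
    TraceBounded (splitMap A B α β (ω - replaceFst 1 α ω - replaceSnd 1 β (ω - replaceFst 1 α ω)))
      (ε * t) := by
  have hH := ((TraceBounded.of_posSemidef hω).sub
    ((TraceBounded.of_posSemidef hω).replaceFst hα))
  have hH := ((hH.sub (hH.replaceSnd hβ)).splitMap hA hB hα hβ).isHermitian
  refine TraceBounded.mono (traceBounded_traceNorm hH) ?_
  have hu := (posSemidef_matSqrt α).1
  have hv := (posSemidef_matSqrt β).1
  have hu1 := hsSq_matSqrt hα
  have hv1 := hsSq_matSqrt hβ
  set K₁ := K - replaceFst (matSqrt α) (matSqrt α) K with hK₁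
  have h1 : ω - replaceFst 1 α ω = root α β θ * K₁ * root α β θ := by
    have h := replaceFst_mul_mul (fourthRoot α) (matSqrt α) (fourthRoot β ⊗ₖ fourthRoot θ) K
    rw [fourthRoot_mul_matSqrt_mul hα.1, fourthRoot_mul_self] at h
    rw [hωK, fourthRoot_kronecker hα.1 (hβ.1.kronecker hθ), fourthRoot_kronecker hβ.1 hθ, h, hK₁,
      Matrix.mul_sub, Matrix.sub_mul, root]
  have h2 : ω - replaceFst 1 α ω - replaceSnd 1 β (ω - replaceFst 1 α ω) =
      root α β θ * (K₁ - replaceSnd (matSqrt β) (matSqrt β) K₁) * root α β θ := by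
    have h := replaceSnd_mul_mul (fourthRoot α) (fourthRoot β) (matSqrt β) (fourthRoot θ) K₁
    rw [fourthRoot_mul_matSqrt_mul hβ.1, fourthRoot_mul_self] at h
    rw [h1, root, h, ← Matrix.sub_mul, ← Matrix.mul_sub]
  rw [h2] at hH ⊢
  refine traceNorm_splitMap_le hA hB hα hβ hθ ht hε hH ?_
  refine (hsSq_sum_placed_le_of_orthogonal hu1 hv1
    (orthogonal_fst_sub_replaceSnd hv (orthogonal_sub_replaceFst hu hu1 K))
    (orthogonal_sub_replaceSnd hv hv1 K₁)).trans ?_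
  calc _ ≤ (A : ℝ) * B * (A * B * t * ε ^ 2) := by
        gcongr
        exact ((hsSq_sub_replaceSnd_le hv hv1 K₁).trans (hsSq_sub_replaceFst_le hu hu1 K)).trans hK
    _ = _ := by ring

/-- Only X is decoupled here: Y costs B², but K lives on X ⊗ M and inserting √β keeps its norm, so
the rate condition on A alone suffices. -/
theorem traceBounded_splitMap_insertSnd (hA : 0 < A) (hB : 0 < B) (hα : IsDensity α)
    (hβ : IsDensity β) (hθ : θ.PosSemidef) (ht : θ.trace.re = t) (hε : 0 ≤ ε)
    {ω K : Matrix (x × m) (x × m) ℂ} (hω : ω.PosSemidef)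
    (hωK : ω = fourthRoot (α ⊗ₖ θ) * K * fourthRoot (α ⊗ₖ θ))
    (hK : hsSq K ≤ A * t * ε ^ 2) :
    TraceBounded (splitMap A B α β (insertSnd β ω - replaceFst 1 α (insertSnd β ω))) (ε * t) := by
  have hH := (TraceBounded.of_posSemidef hω).insertSnd hβ
  have hH := ((hH.sub (hH.replaceFst hα)).splitMap hA hB hα hβ).isHermitian
  refine TraceBounded.mono (traceBounded_traceNorm hH) ?_
  have hu := (posSemidef_matSqrt α).1
  have hu1 := hsSq_matSqrt hα
  have hv1 := hsSq_matSqrt hβ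
  set K₁ := insertSnd (matSqrt β) K with hK₁
  have h0 : hsSq K₁ = hsSq K := by
    rw [hK₁, insertSnd_apply, hsSq_swap, hsSq_kronecker, hv1, one_mul]
  have h1 : insertSnd β ω = root α β θ * K₁ * root α β θ := by
    have h := insertSnd_mul_mul (fourthRoot α) (fourthRoot β) (matSqrt β) (fourthRoot θ) K
    rw [fourthRoot_mul_matSqrt_mul hβ.1] at h
    rw [hωK, fourthRoot_kronecker hα.1 hθ, h, root]
  have h2 : insertSnd β ω - replaceFst 1 α (insertSnd β ω) =
      root α β θ * (K₁ - replaceFst (matSqrt α) (matSqrt α) K₁) * root α β θ := by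
    have h := replaceFst_mul_mul (fourthRoot α) (matSqrt α) (fourthRoot β ⊗ₖ fourthRoot θ) K₁
    rw [fourthRoot_mul_matSqrt_mul hα.1, fourthRoot_mul_self] at h
    rw [h1, root, h, Matrix.mul_sub, Matrix.sub_mul]
  rw [h2] at hH ⊢
  refine traceNorm_splitMap_le hA hB hα hβ hθ ht hε hH ?_
  refine (hsSq_sum_placed_le_of_orthogonal_left hu1 hv1
    (orthogonal_sub_replaceFst hu hu1 K₁)).trans ?_
  calc _ ≤ (A : ℝ) * (B : ℝ) ^ 2 * (A * t * ε ^ 2) := by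
        gcongr
        exact (hsSq_sub_replaceFst_le hu hu1 K₁).trans (h0.trans_le hK)
    _ = _ := by ring

theorem traceBounded_splitMap_insertFst (hA : 0 < A) (hB : 0 < B) (hα : IsDensity α)
    (hβ : IsDensity β) (hθ : θ.PosSemidef) (ht : θ.trace.re = t) (hε : 0 ≤ ε)
    {ω K : Matrix (y × m) (y × m) ℂ} (hω : ω.PosSemidef)
    (hωK : ω = fourthRoot (β ⊗ₖ θ) * K * fourthRoot (β ⊗ₖ θ))
    (hK : hsSq K ≤ B * t * ε ^ 2) :
    TraceBounded (splitMap A B α β (insertFst α ω - replaceSnd 1 β (insertFst α ω))) (ε * t) := by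
  have hH := (TraceBounded.of_posSemidef hω).insertFst hα
  have hH := ((hH.sub (hH.replaceSnd hβ)).splitMap hA hB hα hβ).isHermitian
  refine TraceBounded.mono (traceBounded_traceNorm hH) ?_
  have hv := (posSemidef_matSqrt β).1
  have hu1 := hsSq_matSqrt hα
  have hv1 := hsSq_matSqrt hβ
  set K₁ := insertFst (matSqrt α) K with hK₁
  have h0 : hsSq K₁ = hsSq K := by
    rw [hK₁, insertFst_apply, hsSq_kronecker, hu1, one_mul]
  have h1 : insertFst α ω = root α β θ * K₁ * root α β θ := by
    have h := insertFst_mul_mul (fourthRoot α) (matSqrt α) (fourthRoot β ⊗ₖ fourthRoot θ) K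
    rw [fourthRoot_mul_matSqrt_mul hα.1] at h
    rw [hωK, fourthRoot_kronecker hβ.1 hθ, h, root]
  have h2 : insertFst α ω - replaceSnd 1 β (insertFst α ω) =
      root α β θ * (K₁ - replaceSnd (matSqrt β) (matSqrt β) K₁) * root α β θ := by
    have h := replaceSnd_mul_mul (fourthRoot α) (fourthRoot β) (matSqrt β) (fourthRoot θ) K₁
    rw [fourthRoot_mul_matSqrt_mul hβ.1, fourthRoot_mul_self] at h
    rw [h1, root, h, Matrix.mul_sub, Matrix.sub_mul]
  rw [h2] at hH ⊢
  refine traceNorm_splitMap_le hA hB hα hβ hθ ht hε hH ?_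
  refine (hsSq_sum_placed_le_of_orthogonal_right hu1 hv1
    (orthogonal_sub_replaceSnd hv hv1 K₁)).trans ?_
  calc _ ≤ (A : ℝ) ^ 2 * B * (B * t * ε ^ 2) := by
        gcongr
        exact (hsSq_sub_replaceSnd_le hv hv1 K₁).trans (h0.trans_le hK)
    _ = _ := by ring

/-- The telescoping decomposition of the difference of the convex split state and the fully
decoupled state. -/
theorem convexSplitState_sub_decoupledState (hA : 0 < A) (hB : 0 < B)
    (ρ : Matrix (x × y × m) (x × y × m) ℂ) :
    convexSplitState A B ρ α β - decoupledState A B ρ α β =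
      splitMap A B α β (ρ - replaceFst 1 α ρ - replaceSnd 1 β (ρ - replaceFst 1 α ρ)) +
      splitMap A B α β (insertSnd β (margXM ρ) - replaceFst 1 α (insertSnd β (margXM ρ))) +
      splitMap A B α β (insertFst α (margYM ρ) - replaceSnd 1 β (insertFst α (margYM ρ))) := by
  have h : decoupledState A B ρ α β =
      splitMap A B α β (replaceFst 1 α (replaceSnd 1 β ρ)) := by
    rw [replaceFst_replaceSnd_one, splitMap_kronecker hA hB, decoupledState]
  -- The identity 1 - E_X E_Y = (1-E_Y)(1-E_X) + (1-E_X)E_Y + (1-E_Y)E_X, which needs no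
  -- commutation.
  rw [h, show convexSplitState A B ρ α β = splitMap A B α β ρ from rfl, ← replaceSnd_one_eq,
    ← replaceFst_one_eq]
  simp only [map_sub]
  abel

end Bounds

end ConvexSplit

/-! ### The main theorem -/

open ConvexSplit in
theorem mainTheorem3 {x y m : Type*} [Fintype x] [DecidableEq x] [Fintype y] [DecidableEq y]
    [Fintype m] [DecidableEq m] (A B : ℕ) (hA : 0 < A) (hB : 0 < B)
    (ε : ℝ) (hε0 : 0 < ε) (hε1 : ε < 1)
    (ρ : Matrix (x × y × m) (x × y × m) ℂ) (hρ : ConvexSplit.IsSubnormalised ρ) (hρ0 : ρ ≠ 0)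
    (α : Matrix x x ℂ) (hα : ConvexSplit.IsDensity α)
    (β : Matrix y y ℂ) (hβ : ConvexSplit.IsDensity β)
    (hsα : ConvexSplit.supp (ConvexSplit.margX ρ) ≤ ConvexSplit.supp α)
    (hsβ : ConvexSplit.supp (ConvexSplit.margY ρ) ≤ ConvexSplit.supp β)
    (h1 : ((Real.logb 2 A : ℝ) : EReal) >
      ConvexSplit.smoothD2 ε (ConvexSplit.margXM ρ) (α ⊗ₖ ConvexSplit.margM ρ)
        - ((Real.logb 2 ρ.trace.re : ℝ) : EReal) + ((Real.logb 2 (ε ^ (-2 : ℤ)) : ℝ) : EReal))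
    (h2 : ((Real.logb 2 B : ℝ) : EReal) >
      ConvexSplit.smoothD2 ε (ConvexSplit.margYM ρ) (β ⊗ₖ ConvexSplit.margM ρ)
        - ((Real.logb 2 ρ.trace.re : ℝ) : EReal) + ((Real.logb 2 (ε ^ (-2 : ℤ)) : ℝ) : EReal))
    (h3 : ((Real.logb 2 A + Real.logb 2 B : ℝ) : EReal) >
      ConvexSplit.smoothD2 ε ρ (α ⊗ₖ (β ⊗ₖ ConvexSplit.margM ρ))
        - ((Real.logb 2 ρ.trace.re : ℝ) : EReal) + ((Real.logb 2 (ε ^ (-2 : ℤ)) : ℝ) : EReal)) :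
    ConvexSplit.traceNorm
        (ConvexSplit.convexSplitState A B ρ α β - ConvexSplit.decoupledState A B ρ α β)
      < 16 * ε * ρ.trace.re := by
  have hA' : (0 : ℝ) < A := Nat.cast_pos.mpr hA
  have hB' : (0 : ℝ) < B := Nat.cast_pos.mpr hB
  have hθ := posSemidef_margM hρ.1
  have hθt : (margM ρ).trace.re = ρ.trace.re := by rw [trace_margM]
  have ht : 0 < ρ.trace.re := by
    have h := Complex.nonneg_iff.mp hρ.1.trace_nonneg
    refine h.1.lt_of_ne fun h0 => hρ0 (hρ.1.trace_eq_zero_iff.mp ?_)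
    exact Complex.ext h0.symm h.2.symm
  rw [← Real.logb_mul hA'.ne' hB'.ne'] at h3
  obtain ⟨ω₁, K₁, hω₁, hd₁, hK₁, hs₁⟩ :=
    exists_of_gt_smoothD2 hε0 (hα.1.kronecker hθ) hA' ht h1
  obtain ⟨ω₂, K₂, hω₂, hd₂, hK₂, hs₂⟩ :=
    exists_of_gt_smoothD2 hε0 (hβ.1.kronecker hθ) hB' ht h2
  obtain ⟨ω₃, K₃, hω₃, hd₃, hK₃, hs₃⟩ :=
    exists_of_gt_smoothD2 hε0 (hα.1.kronecker (hβ.1.kronecker hθ)) (mul_pos hA' hB') ht h3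
  rw [trace_margXM] at hd₁
  rw [trace_margYM] at hd₂
  -- Smoothing errors, each at most ε Tr ρ. In the `f` bounds every factor 1-E doubles them: twice
  -- for the full state, once for each marginal.
  have e₁ := ((traceBounded_traceNorm
    (hω₁.1.sub (posSemidef_margXM hρ.1).1)).mono hd₁).insertSnd hβ
  have e₂ := ((traceBounded_traceNorm
    (hω₂.1.sub (posSemidef_margYM hρ.1).1)).mono hd₂).insertFst hα
  have e₃ := (traceBounded_traceNorm (hω₃.1.sub hρ.1.1)).mono hd₃
  have f₁ := (e₁.sub (e₁.replaceFst hα)).splitMap hA hB hα hβ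
  have f₂ := (e₂.sub (e₂.replaceSnd hβ)).splitMap hA hB hα hβ
  have f₃ := e₃.sub (e₃.replaceFst hα)
  have f₃ := (f₃.sub (f₃.replaceSnd hβ)).splitMap hA hB hα hβ
  have g₁ := (traceBounded_splitMap_insertSnd hA hB hα hβ hθ hθt hε0.le hω₁ hK₁ hs₁.le).sub f₁
  have g₂ := (traceBounded_splitMap_insertFst hA hB hα hβ hθ hθt hε0.le hω₂ hK₂ hs₂.le).sub f₂
  have g₃ := (traceBounded_splitMap_sub_sub hA hB hα hβ hθ hθt hε0.le hω₃ hK₃ hs₃.le).sub f₃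
  have g := (g₃.add g₁).add g₂
  -- 11 = (1 + 4) + (1 + 2) + (1 + 2): main term plus smoothing error for each piece. Strictness at
  -- 16 comes from ε Tr ρ > 0.
  have key : TraceBounded (convexSplitState A B ρ α β - decoupledState A B ρ α β)
      (11 * (ε * ρ.trace.re)) := by
    convert g using 1
    · rw [convexSplitState_sub_decoupledState hA hB]
      simp only [map_sub]
      abel
    · ring
  have hpos := mul_pos hε0 ht
  refine key.traceNorm_le.trans_lt ?_
  linarith
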